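/- Let $n\ge 1$. Write a permutation $\pi\in S_n$ as the word $\pi(1)\pi(2)\cdots\pi(n)$. Call $\pi$ an arc permutation if for every $1\le j\le n$ the set $\{\pi(1),\dots,\pi(j)\}$ is an interval in $\mathbb{Z}_n$, that is, a set of the form $[a,b]$ or $[b,n]\cup[1,a]$ with $1\le a\le b\le n$. Call $\pi$ unimodal if for every $1\le j\le n$ the set of its first $j$ letters is an interval $[a,b]$ in $\mathbb{Z}$, or for every $1\le j\le n$ the set of its last $j$ letters is an interval $[a,b]$ in $\mathbb{Z}$. Let $X_n$ be the graph whose vertices are the arc permutations in $S_n$, two of them, $u$ and $v$, being adjacent if and only if $u=v\sigma_i$ for some adjacent transposition $\sigma_i=(i,i+1)$, $1\le i\le n-1$. Let $e=12\cdots n$ and $w_0=n\cdots 21$. Then: (i) $X_n$ is connected and its diameter is $\binom{n}{2}$. (ii) $e$ and $w_0$ are antipodes in $X_n$, that is, their distance in $X_n$ equals the diameter. (iii) The vertices of $X_n$ that lie on a geodesic (shortest path) between $e$ and $w_0$ are exactly the unimodal permutations in $S_n$; if $n\ge 2$, there are $2^n-2$ of them. (iv) If $n\ge 3$, the number of geodesics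 between $e$ and $w_0$ in $X_n$ is $$2\binom{n}{2}!\cdot\prod_{i=0}^{n-2}\frac{i!}{(2i+1)!}.$$ -/

import Mathlib

/-!
Permutations of `{1, …, n}` are elements `π : Equiv.Perm (Fin n)`, the positions and the letters
being shifted to `{0, …, n - 1}`; the `i`-th letter of `π` is `π i`, and the one-line notation
of `π` is `π 0, π 1, …, π (n - 1)`.
-/

namespace ArcPerm

/-- Intervals in `ℤ`: the sets `[a, b]` with `a ≤ b`. -/
def IsInterval {n : ℕ} (s : Finset (Fin n)) : Prop :=
  ∃ a b : Fin n, a ≤ b ∧ s = Finset.Icc a b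

/-- Intervals in `ℤ_n`: the sets `[a, b]` and `[b, n] ∪ [1, a]` with `a ≤ b`. -/
def IsCyclicInterval {n : ℕ} (s : Finset (Fin n)) : Prop :=
  ∃ a b : Fin n, a ≤ b ∧ (s = Finset.Icc a b ∨ s = Finset.Ici b ∪ Finset.Iic a)

/-- The set of the first `j` letters of `π`. -/
def prefixLetters {n : ℕ} (π : Equiv.Perm (Fin n)) (j : ℕ) : Finset (Fin n) :=
  (Finset.univ.filter fun i : Fin n => (i : ℕ) < j).image π

/-- The set of the last `j` letters of `π`. -/
def suffixLetters {n : ℕ} (π : Equiv.Perm (Fin n)) (j : ℕ) : Finset (Fin n) :=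
  (Finset.univ.filter fun i : Fin n => n ≤ (i : ℕ) + j).image π

/-- Arc permutations: every nonempty prefix forms an interval in `ℤ_n`. -/
def IsArc {n : ℕ} (π : Equiv.Perm (Fin n)) : Prop :=
  ∀ j : ℕ, 1 ≤ j → j ≤ n → IsCyclicInterval (prefixLetters π j)

/-- Unimodal permutations: every nonempty prefix forms an interval in `ℤ`, or every nonempty
suffix does. -/
def IsUnimodal {n : ℕ} (π : Equiv.Perm (Fin n)) : Prop :=
  (∀ j : ℕ, 1 ≤ j → j ≤ n → IsInterval (prefixLetters π j)) ∨
    (∀ j : ℕ, 1 ≤ j → j ≤ n → IsInterval (suffixLetters π j))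

/-- The simple reflections, that is, the transpositions of two adjacent elements. -/
def simpleReflections (n : ℕ) : Set (Equiv.Perm (Fin n)) :=
  {σ | ∃ i j : Fin n, (i : ℕ) + 1 = (j : ℕ) ∧ σ = Equiv.swap i j}

/-- The graph `X_n`: the subgraph of the (right) Cayley graph of the symmetric group with respect
to the simple reflections that is induced on the arc permutations. -/
def arcGraph (n : ℕ) : SimpleGraph {π : Equiv.Perm (Fin n) // IsArc π} :=
  (SimpleGraph.mulCayley (simpleReflections n)).induce {π | IsArc π}

theorem isArc_one (n : ℕ) : IsArc (1 : Equiv.Perm (Fin n)) := by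
  intro j h1 hj
  refine ⟨⟨0, by omega⟩, ⟨j - 1, by omega⟩, by simp [Fin.le_def], Or.inl ?_⟩
  ext x
  simp only [prefixLetters, Finset.mem_image, Finset.mem_filter, Finset.mem_univ, true_and,
    Equiv.Perm.coe_one, id_eq, exists_eq_right, Finset.mem_Icc, Fin.le_def]
  omega

theorem isArc_revPerm (n : ℕ) : IsArc (Fin.revPerm : Equiv.Perm (Fin n)) := by
  intro j h1 hj
  refine ⟨⟨n - j, by omega⟩, ⟨n - 1, by omega⟩, by simp only [Fin.le_def]; omega, Or.inl ?_⟩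
  ext x
  simp only [prefixLetters, Finset.mem_image, Finset.mem_filter, Finset.mem_univ, true_and,
    Fin.revPerm_apply, Finset.mem_Icc, Fin.le_def]
  constructor
  · rintro ⟨y, hy, rfl⟩
    simp only [Fin.val_rev]
    omega
  · rintro ⟨hx, -⟩
    refine ⟨x.rev, ?_, Fin.rev_rev x⟩
    simp only [Fin.val_rev]
    omega

/-- The identity `e = 12…n`, as a vertex of `X_n`. -/
def e (n : ℕ) : {π : Equiv.Perm (Fin n) // IsArc π} := ⟨1, isArc_one n⟩

/-- The longest element `w₀ = n…21`, as a vertex of `X_n`. -/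
def w₀ (n : ℕ) : {π : Equiv.Perm (Fin n) // IsArc π} := ⟨Fin.revPerm, isArc_revPerm n⟩

/-- Two vertices of a connected graph are antipodes if their distance is the diameter. -/
def AreAntipodes {V : Type*} (G : SimpleGraph V) (u v : V) : Prop :=
  G.dist u v = G.diam

/-- The geodesics from `u` to `v`: the walks whose length is the distance of `u` and `v`. -/
def geodesics {V : Type*} (G : SimpleGraph V) (u v : V) : Set (G.Walk u v) :=
  {p | p.length = G.dist u v}

/-- The vertices lying on at least one geodesic from `u` to `v`. -/
def geodesicVertices {V : Type*} (G : SimpleGraph V) (u v : V) : Set V :=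
  {x | ∃ p ∈ geodesics G u v, x ∈ p.support}

end ArcPerm

namespace ArcPerm

open Finset

/-! The proof unrolls `ℤ_n` to `ℤ`. Each proper nonempty prefix of an arc permutation is an arc
modulo `n`, and its left end stays put or moves back by one as the prefix grows. Choosing integer
representatives gives a sequence `k 1, …, k (n - 1)` with steps `0` or `-1`, a lift. It determines
the permutation and is unique up to adding one multiple of `n` to all terms
(`IsLift.exists_eq_add`). An edge of `X_n` changes exactly one term by `±1` (`IsLift.update`,
`IsLift.exists_update`), so distance in `X_n` is the `ℓ¹` distance of lifts, minimised over these
translations.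

Diameter: the difference of two lifts varies by at most one per step. Either it meets a multiple of
`n`, and translating it to `0` there gives the bound, or it stays between two consecutive multiples,
and the two corresponding distances add up to `n (n - 1)` (`IsPath.exists_pathDist_le`). The lifts
of `w₀` closest to the zero lift of `e` are `n - j` and `-j`, both at distance `n.choose 2`.

Geodesics: equality in the triangle inequality confines lifts to the region between `0` and `n - j`,
or between `-j` and `0`; these regions encode interval prefixes and interval suffixes, and
conjugation by `w₀` exchanges them. Sequences in the upper region are the column lengths of shifted
shapes with distinct parts in `{1, …, n - 1}`. Geodesics inside it therefore count standard tableaux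
of the shifted staircase. Schur and Thrall's formula is obtained from its box-removal recurrence, a
case of Lagrange interpolation (`sum_mul_prod_div_eq`). The two regions account for the factor `2`.
-/

/-! ### Residues and arcs modulo `n`. -/

theorem emod_of_small {n z : ℤ} (h1 : -n ≤ z) (h2 : z < n) :
    z % n = if 0 ≤ z then z else z + n := by
  split_ifs with h
  · exact Int.emod_eq_of_lt h h2
  · rw [← Int.add_emod_right]
    exact Int.emod_eq_of_lt (by omega) (by omega)

theorem sub_one_emod {n : ℤ} (hn : 0 < n) (z : ℤ) :
    (z - 1) % n = if z % n = 0 then n - 1 else z % n - 1 := by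
  have h1 := Int.emod_nonneg z hn.ne'
  have h2 := Int.emod_lt_of_pos z hn
  rw [← Int.emod_sub_emod, emod_of_small (by omega) (by omega)]
  split_ifs <;> omega

/-- The arc `a, a + 1, …, a + j - 1` modulo `n`. -/
def arc (n : ℕ) (a : ℤ) (j : ℕ) : Finset (Fin n) :=
  univ.filter fun x => ((x : ℤ) - a) % n < j

theorem mem_arc {n : ℕ} {a : ℤ} {j : ℕ} {x : Fin n} : x ∈ arc n a j ↔ ((x : ℤ) - a) % n < j := by
  simp [arc]

theorem arc_congr {n : ℕ} {a b : ℤ} (j : ℕ) (h : (n : ℤ) ∣ a - b) : arc n a j = arc n b j := by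
  ext x
  rw [mem_arc, mem_arc]
  have : ((x : ℤ) - a) % n = (x - b) % n := by
    apply Int.emod_emod_of_dvd _ (dvd_refl _) |>.symm.trans
    rw [Int.emod_emod]
    apply Int.ModEq.symm
    rw [Int.modEq_iff_dvd]
    have : (x : ℤ) - a - (x - b) = -(a - b) := by ring
    rw [this]
    exact h.neg_right
  rw [this]

theorem exists_letter {n : ℕ} (hn : 0 < n) (z : ℤ) : ∃ x : Fin n, (n : ℤ) ∣ x - z := by
  have h1 := Int.emod_nonneg z (b := n) (by omega)
  have h2 := Int.emod_lt_of_pos z (b := n) (by omega)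
  refine ⟨⟨(z % n).toNat, by omega⟩, ?_⟩
  simp only [Int.toNat_of_nonneg h1]
  have := Int.dvd_sub_self_of_emod_eq (a := z) (b := n) rfl
  exact this

theorem exists_emod_eq {n : ℕ} (hn : 0 < n) (z c : ℤ) (h0 : 0 ≤ c) (h1 : c < n) :
    ∃ x : Fin n, ((x : ℤ) - z) % n = c := by
  obtain ⟨x, q, hq⟩ := exists_letter hn (z + c)
  refine ⟨x, ?_⟩
  have : (x : ℤ) - z = c + n * q := by linarith
  rw [this, Int.add_mul_emod_self_left, Int.emod_eq_of_lt h0 h1]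

/-- A nested arc that is shorter by one starts at the same point or one step later. -/
theorem dvd_of_arc_subset {n : ℕ} {a b : ℤ} {j : ℕ} (hj : 1 ≤ j) (hjn : j + 1 < n)
    (h : arc n a j ⊆ arc n b (j + 1)) : (n : ℤ) ∣ a - b ∨ (n : ℤ) ∣ a - b - 1 := by
  have hn : 0 < n := by omega
  have r0 := Int.emod_nonneg (a - b) (b := n) (by omega)
  have r1 := Int.emod_lt_of_pos (a - b) (b := n) (by omega)
  set r := (a - b) % n with hr
  obtain ⟨q, hq⟩ : ∃ q : ℤ, a - b = r + n * q := ⟨(a - b) / n, (Int.emod_add_mul_ediv _ _).symm⟩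
  rcases lt_or_ge 1 r with h2 | h2
  · exfalso
    have hra : r ≤ j := by
      obtain ⟨x, hx⟩ := exists_emod_eq hn a 0 le_rfl (by omega)
      have hxa : x ∈ arc n a j := by rw [mem_arc, hx]; omega
      have := mem_arc.1 (h hxa)
      have h3 : ((x : ℤ) - b) % n = r := by
        have : (x : ℤ) - b = (x - a) + r + n * q := by linarith
        rw [this, Int.add_mul_emod_self_left, ← Int.emod_add_emod, hx, zero_add,
          Int.emod_eq_of_lt r0 r1]
      omega
    -- The first point beyond the longer arc; an offset `r ≥ 2` would put it inside the shorter one.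
    obtain ⟨x, hx⟩ := exists_emod_eq hn b (j + 1) (by omega) (by omega)
    have h3 : ((x : ℤ) - a) % n = j + 1 - r := by
      have : (x : ℤ) - a = (x - b) + (-r) + n * (-q) := by linarith
      rw [this, Int.add_mul_emod_self_left, ← Int.emod_add_emod, hx,
        Int.emod_eq_of_lt (by omega) (by omega)]
      ring
    have hxa : x ∈ arc n a j := by rw [mem_arc, h3]; omega
    have := mem_arc.1 (h hxa)
    push_cast at this
    omega
  · rcases (by omega : r = 0 ∨ r = 1) with h3 | h3
    · left; exact ⟨q, by linarith⟩
    · right; exact ⟨q, by linarith⟩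

/-- If the starts differed modulo `n`, the point just past the arc from `b` would lie in the arc
from `a`. Properness `j < n` is essential: the full circle has no start. -/
theorem dvd_of_arc_eq {n : ℕ} {a b : ℤ} {j : ℕ} (hj : 1 ≤ j) (hjn : j < n)
    (h : arc n a j = arc n b j) : (n : ℤ) ∣ a - b := by
  have hn : 0 < n := by omega
  have r0 := Int.emod_nonneg (a - b) (b := n) (by omega)
  have r1 := Int.emod_lt_of_pos (a - b) (b := n) (by omega)
  set r := (a - b) % n with hr
  obtain ⟨q, hq⟩ : ∃ q : ℤ, a - b = r + n * q := ⟨(a - b) / n, (Int.emod_add_mul_ediv _ _).symm⟩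
  by_contra hcon
  have hr0 : r ≠ 0 := fun h0 => hcon ⟨q, by linarith⟩
  have hra : r < j := by
    obtain ⟨x, hx⟩ := exists_emod_eq hn a 0 le_rfl (by omega)
    have hxa : x ∈ arc n a j := by rw [mem_arc, hx]; omega
    have := mem_arc.1 (h ▸ hxa)
    have h3 : ((x : ℤ) - b) % n = r := by
      have : (x : ℤ) - b = (x - a) + r + n * q := by linarith
      rw [this, Int.add_mul_emod_self_left, ← Int.emod_add_emod, hx, zero_add,
        Int.emod_eq_of_lt r0 r1]
    omega
  obtain ⟨x, hx⟩ := exists_emod_eq hn b j (by omega) (by omega)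
  have h3 : ((x : ℤ) - a) % n = j - r := by
    have : (x : ℤ) - a = (x - b) + (-r) + n * (-q) := by linarith
    rw [this, Int.add_mul_emod_self_left, ← Int.emod_add_emod, hx,
      Int.emod_eq_of_lt (by omega) (by omega)]
    ring
  have hxa : x ∈ arc n a j := by rw [mem_arc, h3]; omega
  have := mem_arc.1 (h ▸ hxa)
  omega

theorem arc_eq_Icc {n : ℕ} {j : ℕ} (a b : Fin n) (h : (a : ℕ) + j = b + 1) :
    arc n (a : ℕ) j = Icc a b := by
  ext x
  rw [mem_arc, mem_Icc, Fin.le_def, Fin.le_def, emod_of_small (by omega) (by omega)]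
  split_ifs <;> omega

theorem arc_eq_Ici_union_Iic {n : ℕ} {j : ℕ} (a b : Fin n) (_hab : a < b)
    (h : (b : ℕ) + j = n + a + 1) : arc n (b : ℕ) j = Ici b ∪ Iic a := by
  ext x
  rw [mem_arc, mem_union, mem_Ici, mem_Iic, Fin.le_def, Fin.le_def,
    emod_of_small (by omega) (by omega)]
  split_ifs <;> omega

/-! ### Prefixes and suffixes of a permutation. -/

theorem mem_prefixLetters {n : ℕ} {π : Equiv.Perm (Fin n)} {j : ℕ} {x : Fin n} :
    x ∈ prefixLetters π j ↔ (π.symm x : ℕ) < j := by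
  simp only [prefixLetters, mem_image, mem_filter, mem_univ, true_and]
  constructor
  · rintro ⟨y, hy, rfl⟩
    simpa using hy
  · intro h
    exact ⟨π.symm x, h, by simp⟩

theorem mem_suffixLetters {n : ℕ} {π : Equiv.Perm (Fin n)} {j : ℕ} {x : Fin n} :
    x ∈ suffixLetters π j ↔ n ≤ (π.symm x : ℕ) + j := by
  simp only [suffixLetters, mem_image, mem_filter, mem_univ, true_and]
  constructor
  · rintro ⟨y, hy, rfl⟩
    simpa using hy
  · intro h
    exact ⟨π.symm x, h, by simp⟩

theorem prefixLetters_mono {n : ℕ} (π : Equiv.Perm (Fin n)) {i j : ℕ} (h : i ≤ j) :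
    prefixLetters π i ⊆ prefixLetters π j := by
  intro x
  rw [mem_prefixLetters, mem_prefixLetters]
  omega

theorem card_prefixLetters {n : ℕ} (π : Equiv.Perm (Fin n)) {j : ℕ} (h : j ≤ n) :
    (prefixLetters π j).card = j := by
  rw [prefixLetters, card_image_of_injective _ π.injective, Fin.card_filter_val_lt]
  omega

theorem perm_ext_of_prefixLetters {n : ℕ} {π π' : Equiv.Perm (Fin n)}
    (h : ∀ j, 1 ≤ j → j < n → prefixLetters π j = prefixLetters π' j) : π = π' := by
  have key : π.symm = π'.symm := by
    ext x
    have hx := (π.symm x).2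
    have hx' := (π'.symm x).2
    have h1 : ∀ j, 1 ≤ j → j < n → ((π.symm x : ℕ) < j ↔ (π'.symm x : ℕ) < j) := by
      intro j h1 h2
      rw [← mem_prefixLetters, ← mem_prefixLetters, h j h1 h2]
    have h2 := h1 ((π.symm x : ℕ) + 1) (by omega)
    have h3 := h1 ((π'.symm x : ℕ) + 1) (by omega)
    omega
  rw [← π.symm_symm, key, π'.symm_symm]

/-! ### Lifts of arc permutations to integer sequences. -/

/-- The sequences of left ends of the lifts to `ℤ` of the prefixes of arc permutations. -/
def IsPath (n : ℕ) (k : ℕ → ℤ) : Prop :=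
  ∀ j, 1 ≤ j → j + 1 < n → k (j + 1) = k j ∨ k (j + 1) = k j - 1

/-- `k` is a lift of `π`: the prefix of length `j` of `π` is the arc from `k j` of length `j`. -/
structure IsLift {n : ℕ} (k : ℕ → ℤ) (π : Equiv.Perm (Fin n)) : Prop where
  isPath : IsPath n k
  letters_eq : ∀ j, 1 ≤ j → j < n → prefixLetters π j = arc n (k j) j

theorem IsLift.perm_unique {n : ℕ} {k k' : ℕ → ℤ} {π π' : Equiv.Perm (Fin n)} (h : IsLift k π)
    (h' : IsLift k' π') (hk : ∀ j, 1 ≤ j → j < n → k j = k' j) : π = π' :=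
  perm_ext_of_prefixLetters fun j h1 h2 => by
    rw [h.letters_eq j h1 h2, h'.letters_eq j h1 h2, hk j h1 h2]

theorem IsLift.add_mul {n : ℕ} {k : ℕ → ℤ} {π : Equiv.Perm (Fin n)} (h : IsLift k π) (t : ℤ) :
    IsLift (fun j => k j + n * t) π where
  isPath j h1 h2 := by
    have := h.isPath j h1 h2
    dsimp only
    omega
  letters_eq j h1 h2 := by
    rw [h.letters_eq j h1 h2]
    exact arc_congr _ ⟨-t, by ring⟩

/-- The differences `k' j - k j` are multiples of `n`, and consecutive ones differ by at most one,
hence not at all when `n ≥ 2`. -/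
theorem IsLift.exists_eq_add {n : ℕ} {k k' : ℕ → ℤ} {π : Equiv.Perm (Fin n)} (h : IsLift k π)
    (h' : IsLift k' π) : ∃ t : ℤ, ∀ j, 1 ≤ j → j < n → k' j = k j + n * t := by
  rcases Nat.lt_or_ge 1 n with hn | hn
  swap
  · exact ⟨0, fun j h1 h2 => by omega⟩
  have hd : ∀ j, 1 ≤ j → j < n → (n : ℤ) ∣ k' j - k j := fun j h1 h2 =>
    dvd_of_arc_eq h1 h2 (by rw [← h.letters_eq j h1 h2, ← h'.letters_eq j h1 h2])
  obtain ⟨t, ht⟩ := hd 1 le_rfl hn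
  refine ⟨t, fun j h1 => ?_⟩
  induction j, h1 using Nat.le_induction with
  | base => intro _; linarith
  | succ j h1 ih =>
    intro h2
    have ih := ih (by omega)
    obtain ⟨s, hs⟩ := hd (j + 1) (by omega) h2
    have a1 := h.isPath j h1 h2
    have a2 := h'.isPath j h1 h2
    have e1 : (n : ℤ) * (s - t) ≤ 1 := by rw [mul_sub]; omega
    have e2 : -1 ≤ (n : ℤ) * (s - t) := by rw [mul_sub]; omega
    have hst : s - t = 0 := by
      by_contra h0
      rcases lt_or_gt_of_ne h0 with h0 | h0
      · nlinarith
      · nlinarith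
    have : s = t := by omega
    subst this
    linarith

theorem IsCyclicInterval.exists_arc {n : ℕ} {s : Finset (Fin n)} {j : ℕ} (h : IsCyclicInterval s)
    (hs : s.card = j) (hj : j < n) : ∃ a : ℤ, s = arc n a j := by
  obtain ⟨a, b, hab, rfl | rfl⟩ := h
  · refine ⟨(a : ℕ), (arc_eq_Icc a b ?_).symm⟩
    rw [Fin.card_Icc] at hs
    rw [Fin.le_def] at hab
    omega
  · rcases hab.lt_or_eq with hab | rfl
    · refine ⟨(b : ℕ), (arc_eq_Ici_union_Iic a b hab ?_).symm⟩
      rw [card_union_of_disjoint, Fin.card_Ici, Fin.card_Iic] at hs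
      · omega
      · rw [disjoint_left]
        intro x h1 h2
        rw [mem_Ici] at h1
        rw [mem_Iic] at h2
        exact absurd (h1.trans h2) (not_le.2 hab)
    -- For `a = b` the wrapped interval is the whole set, which the cardinality excludes.
    · exfalso
      have : Ici a ∪ Iic a = univ := by
        ext x
        simp only [mem_union, mem_Ici, mem_Iic, mem_univ, iff_true]
        exact le_total _ _
      rw [this, card_univ, Fintype.card_fin] at hs
      omega

theorem isCyclicInterval_arc {n : ℕ} (a : ℤ) {j : ℕ} (h1 : 1 ≤ j) (h2 : j < n) :
    IsCyclicInterval (arc n a j) := by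
  obtain ⟨x, hx⟩ := exists_letter (n := n) (by omega) a
  rw [← arc_congr j hx]
  rcases Nat.lt_or_ge n ((x : ℕ) + j) with h | h
  · refine ⟨⟨x + j - n - 1, by omega⟩, x, by rw [Fin.le_def]; simp only; omega, Or.inr ?_⟩
    apply arc_eq_Ici_union_Iic
    · rw [Fin.lt_def]; simp only; omega
    · simp only; omega
  · refine ⟨x, ⟨x + j - 1, by omega⟩, by rw [Fin.le_def]; simp only; omega, Or.inl ?_⟩
    apply arc_eq_Icc
    simp only; omega

theorem IsLift.isArc {n : ℕ} {k : ℕ → ℤ} {π : Equiv.Perm (Fin n)} (h : IsLift k π) : IsArc π := by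
  intro j h1 h2
  rcases h2.lt_or_eq with h2 | rfl
  · rw [h.letters_eq j h1 h2]
    exact isCyclicInterval_arc _ h1 h2
  · refine ⟨⟨0, by omega⟩, ⟨j - 1, by omega⟩, by rw [Fin.le_def]; simp only; omega, Or.inl ?_⟩
    ext x
    rw [mem_prefixLetters, mem_Icc, Fin.le_def, Fin.le_def]
    simp only
    omega

theorem IsArc.exists_lift {n : ℕ} {π : Equiv.Perm (Fin n)} (h : IsArc π) :
    ∃ k : ℕ → ℤ, IsLift k π := by
  have h1 : ∀ j, ∃ a : ℤ, 1 ≤ j → j < n → prefixLetters π j = arc n a j := by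
    intro j
    by_cases hj : 1 ≤ j ∧ j < n
    · obtain ⟨a, ha⟩ := (h j hj.1 hj.2.le).exists_arc (card_prefixLetters π hj.2.le) hj.2
      exact ⟨a, fun _ _ => ha⟩
    · exact ⟨0, fun h1 h2 => absurd ⟨h1, h2⟩ hj⟩
  choose a ha using h1
  -- The starts `a i` are arbitrary representatives; only whether the start moves back is read off,
  -- and the lift is rebuilt from these decrements.
  set d : ℕ → ℤ := fun i => if (n : ℤ) ∣ a i - a (i + 1) then 0 else 1 with hd
  set k : ℕ → ℤ := fun j => a 1 - ∑ i ∈ Ico 1 j, d i with hk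
  have hstep : ∀ j, 1 ≤ j → k (j + 1) = k j - d j := by
    intro j hj
    simp only [hk]
    rw [sum_Ico_succ_top hj]
    ring
  refine ⟨k, fun j h1 h2 => ?_, fun j h1 => ?_⟩
  · rw [hstep j h1, hd]
    simp only
    split_ifs <;> simp
  · intro h2
    rw [ha j h1 h2]
    apply arc_congr
    induction j, h1 using Nat.le_induction with
    | base => simp [hk]
    | succ j h1 ih =>
      have ih := ih (by omega)
      rw [hstep j h1]
      have hsub : arc n (a j) j ⊆ arc n (a (j + 1)) (j + 1) := by
        rw [← ha j h1 (by omega), ← ha (j + 1) (by omega) h2]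
        exact prefixLetters_mono π (by omega)
      by_cases hdv : (n : ℤ) ∣ a j - a (j + 1)
      · have : d j = 0 := by simp [hd, hdv]
        rw [this, show a (j + 1) - (k j - 0) = a j - k j - (a j - a (j + 1)) by ring]
        exact dvd_sub ih hdv
      · have h3 := (dvd_of_arc_subset h1 h2 hsub).resolve_left hdv
        have : d j = 1 := by simp [hd, hdv]
        rw [this, show a (j + 1) - (k j - 1) = a j - k j - (a j - a (j + 1) - 1) by ring]
        exact dvd_sub ih h3

/-! ### Edges of `X_n` as unit changes of a lift. -/

/-- The transposition exchanging the letters in the positions `j - 1` and `j`. -/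
def simpleSwap {n : ℕ} (j : ℕ) (h1 : 1 ≤ j) (h2 : j < n) : Equiv.Perm (Fin n) :=
  Equiv.swap ⟨j - 1, by omega⟩ ⟨j, h2⟩

theorem mem_prefixLetters_mul_simpleSwap {n : ℕ} (π : Equiv.Perm (Fin n)) {j : ℕ} (h1 : 1 ≤ j)
    (h2 : j < n) (i : ℕ) (x : Fin n) : x ∈ prefixLetters (π * simpleSwap j h1 h2) i ↔
      if i = j then x ∈ prefixLetters π (j - 1) ∨
        (x ∈ prefixLetters π (j + 1) ∧ x ∉ prefixLetters π j) else x ∈ prefixLetters π i := by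
  simp only [mem_prefixLetters]
  have : (π * simpleSwap j h1 h2).symm x = simpleSwap j h1 h2 (π.symm x) := by
    rw [Equiv.symm_apply_eq]
    simp [simpleSwap]
  rw [this, simpleSwap, Equiv.swap_apply_def]
  generalize π.symm x = p
  simp only [Fin.ext_iff]
  split_ifs <;> (try simp only) <;> omega

theorem simpleSwap_mem {n : ℕ} {j : ℕ} (h1 : 1 ≤ j) (h2 : j < n) :
    simpleSwap j h1 h2 ∈ simpleReflections n :=
  ⟨⟨j - 1, by omega⟩, ⟨j, h2⟩, by simp only; omega, rfl⟩

theorem simpleSwap_ne_one {n : ℕ} {j : ℕ} (h1 : 1 ≤ j) (h2 : j < n) :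
    simpleSwap j h1 h2 ≠ 1 := by
  rw [simpleSwap, Ne, Equiv.swap_eq_one_iff, Fin.ext_iff]
  simp only
  omega

theorem arcGraph_adj_iff {n : ℕ} (u v : {π : Equiv.Perm (Fin n) // IsArc π}) :
    (arcGraph n).Adj u v ↔ ∃ (j : ℕ) (h1 : 1 ≤ j) (h2 : j < n),
      v.1 = u.1 * simpleSwap j h1 h2 := by
  have hs : ∀ {j : ℕ} (h1 : 1 ≤ j) (h2 : j < n), simpleSwap j h1 h2 * simpleSwap j h1 h2 = 1 :=
    fun _ _ => Equiv.swap_mul_self _ _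
  rw [arcGraph]
  change (SimpleGraph.mulCayley (simpleReflections n)).Adj u.1 v.1 ↔ _
  rw [SimpleGraph.mulCayley_adj']
  constructor
  · rintro ⟨-, g, ⟨i, j, hij, rfl⟩, h⟩
    have hg : Equiv.swap i j = simpleSwap (n := n) (j : ℕ) (by omega) j.2 := by
      rw [simpleSwap]
      congr 1
      exact Fin.ext (by simp only; omega)
    rw [hg] at h
    refine ⟨j, by omega, j.2, ?_⟩
    rcases h with h | h
    · exact h.symm
    · rw [h, mul_assoc, hs, mul_one]
  · rintro ⟨j, h1, h2, h⟩
    refine ⟨fun huv => ?_, _, simpleSwap_mem h1 h2, Or.inl h.symm⟩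
    rw [← huv, left_eq_mul] at h
    exact simpleSwap_ne_one h1 h2 h

theorem arc_add_one_eq {n j : ℕ} (h1 : 1 ≤ j) (h2 : j < n) (a : ℤ) (x : Fin n) :
    x ∈ arc n (a + 1) j ↔
      x ∈ arc n (a + 1) (j - 1) ∨ (x ∈ arc n a (j + 1) ∧ x ∉ arc n a j) := by
  have r0 := Int.emod_nonneg ((x : ℤ) - a) (b := n) (by omega)
  have r1 := Int.emod_lt_of_pos ((x : ℤ) - a) (b := n) (by omega)
  simp only [mem_arc, ← sub_sub, sub_one_emod (show 0 < (n : ℤ) by omega)]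
  push_cast [h1]
  split_ifs <;> omega

theorem arc_sub_one_eq {n j : ℕ} (h1 : 1 ≤ j) (h2 : j < n) (a : ℤ) (x : Fin n) :
    x ∈ arc n (a - 1) j ↔
      x ∈ arc n a (j - 1) ∨ (x ∈ arc n (a - 1) (j + 1) ∧ x ∉ arc n a j) := by
  obtain ⟨a, rfl⟩ : ∃ c, a = c + 1 := ⟨a - 1, by ring⟩
  have r0 := Int.emod_nonneg ((x : ℤ) - a) (b := n) (by omega)
  have r1 := Int.emod_lt_of_pos ((x : ℤ) - a) (b := n) (by omega)
  simp only [mem_arc, ← sub_sub, add_sub_cancel_right, sub_one_emod (show 0 < (n : ℤ) by omega)]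
  push_cast [h1]
  split_ifs <;> omega

theorem not_mem_arc_zero {n : ℕ} (a : ℤ) (x : Fin n) : x ∉ arc n a 0 := by
  rw [mem_arc]
  have := Int.emod_nonneg ((x : ℤ) - a) (b := n) (by have := x.2; omega)
  push_cast
  omega

theorem mem_arc_self {n : ℕ} (a : ℤ) (x : Fin n) : x ∈ arc n a n := by
  rw [mem_arc]
  exact Int.emod_lt_of_pos _ (by have := x.2; omega)

/-- Includes the empty and the full prefix, where any start `a` will do, so that the neighbours `j -
1` and `j + 1` need no boundary cases. -/
theorem IsLift.mem_prefixLetters_iff {n : ℕ} {k : ℕ → ℤ} {π : Equiv.Perm (Fin n)}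
    (h : IsLift k π) {j : ℕ} {a : ℤ} (hj : j ≤ n) (ha : 1 ≤ j → j < n → a = k j) (x : Fin n) :
    x ∈ prefixLetters π j ↔ x ∈ arc n a j := by
  by_cases h1 : j = 0
  · subst h1
    simp [mem_prefixLetters, not_mem_arc_zero]
  by_cases h2 : j = n
  · subst h2
    simp [mem_prefixLetters, mem_arc_self]
  rw [h.letters_eq j (by omega) (by omega), ha (by omega) (by omega)]

theorem IsPath.update {n : ℕ} {k : ℕ → ℤ} (h : IsPath n k) {j : ℕ} {b : ℤ}
    (hl : 2 ≤ j → j < n → b = k (j - 1) ∨ b = k (j - 1) - 1)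
    (hr : 1 ≤ j → j + 1 < n → k (j + 1) = b ∨ k (j + 1) = b - 1) :
    IsPath n (Function.update k j b) := by
  intro i h1 h2
  by_cases h3 : i = j
  · subst h3
    simpa using hr h1 h2
  by_cases h4 : i + 1 = j
  · subst h4
    simpa [Function.update_of_ne h3] using hl (by omega) h2
  · rw [Function.update_of_ne h3, Function.update_of_ne h4]
    exact h i h1 h2

theorem IsLift.update {n : ℕ} {k : ℕ → ℤ} {π : Equiv.Perm (Fin n)} (h : IsLift k π) {j : ℕ}
    (h1 : 1 ≤ j) (h2 : j < n) {b : ℤ} (hb : b = k j + 1 ∨ b = k j - 1)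
    (hp : IsPath n (Function.update k j b)) :
    IsLift (Function.update k j b) (π * simpleSwap j h1 h2) := by
  refine ⟨hp, fun i hi1 hi2 => ?_⟩
  ext x
  rw [mem_prefixLetters_mul_simpleSwap]
  by_cases hij : i = j
  swap
  · rw [if_neg hij, h.letters_eq i hi1 hi2, Function.update_of_ne hij]
  subst hij
  rw [if_pos rfl, Function.update_self]
  -- Both the old and the new value fit between the neighbours, which forces the left neighbour to
  -- be the larger and the right neighbour the smaller of the two.
  have hl : 1 ≤ i - 1 → k (i - 1) = max (k i) b := by
    intro h3
    have e1 := h.isPath (i - 1) h3 (by omega)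
    have e2 := hp (i - 1) h3 (by omega)
    rw [Nat.sub_add_cancel h1, Function.update_self, Function.update_of_ne (by omega)] at e2
    rw [Nat.sub_add_cancel h1] at e1
    omega
  have hr : i + 1 < n → k (i + 1) = min (k i) b := by
    intro h3
    have e1 := h.isPath i h1 h3
    have e2 := hp i h1 h3
    rw [Function.update_self, Function.update_of_ne (by omega)] at e2
    omega
  rw [h.mem_prefixLetters_iff (a := max (k i) b) (by omega) (fun h3 _ => (hl h3).symm),
    h.mem_prefixLetters_iff (a := min (k i) b) (by omega) (fun _ h3 => (hr h3).symm),
    h.letters_eq i h1 h2]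
  rcases hb with rfl | rfl
  · rw [arc_add_one_eq h1 h2, max_eq_right (by omega), min_eq_left (by omega)]
  · rw [arc_sub_one_eq h1 h2, max_eq_left (by omega), min_eq_right (by omega)]

theorem eq_zero_of_abs_mul_lt {n : ℕ} {q c : ℤ} (hc : c = n * q) (h1 : c < n) (h2 : -n < c) :
    c = 0 := by
  have : q = 0 := by
    by_contra h0
    rcases lt_or_gt_of_ne h0 with h0 | h0 <;> nlinarith
  simp [hc, this]

/-- A move in `X_n` changes one coordinate of a lift by one. -/
theorem IsLift.exists_update {n : ℕ} {k : ℕ → ℤ} {π : Equiv.Perm (Fin n)} (h : IsLift k π)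
    {j : ℕ} (h1 : 1 ≤ j) (h2 : j < n) (hπ : IsArc (π * simpleSwap j h1 h2)) :
    ∃ b : ℤ, (b = k j + 1 ∨ b = k j - 1) ∧
      IsLift (Function.update k j b) (π * simpleSwap j h1 h2) := by
  set π' := π * simpleSwap j h1 h2 with hπ'
  have hne : π ≠ π' := by
    rw [hπ', Ne, left_eq_mul]
    exact simpleSwap_ne_one h1 h2
  have hpre : ∀ i, i ≠ j → prefixLetters π' i = prefixLetters π i := by
    intro i hi
    ext x
    rw [hπ', mem_prefixLetters_mul_simpleSwap, if_neg hi]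
  obtain ⟨a, ha⟩ := (hπ j h1 h2.le).exists_arc (card_prefixLetters π' h2.le) h2
  suffices hb : ∃ b : ℤ, (n : ℤ) ∣ a - b ∧ (b = k j + 1 ∨ b = k j ∨ b = k j - 1) ∧
      IsPath n (Function.update k j b) by
    obtain ⟨b, hab, hbk, hb⟩ := hb
    have hL : IsLift (Function.update k j b) π' := by
      refine ⟨hb, fun i hi1 hi2 => ?_⟩
      by_cases hij : i = j
      · subst hij
        rw [ha, Function.update_self]
        exact arc_congr _ hab
      · rw [hpre i hij, Function.update_of_ne hij, h.letters_eq i hi1 hi2]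
    refine ⟨b, ?_, hL⟩
    by_cases hbk' : b = k j
    · refine absurd (h.perm_unique hL fun i _ _ => ?_) hne
      rw [hbk', Function.update_eq_self]
    · tauto
  have hup : 1 ≤ j → j + 1 < n → (n : ℤ) ∣ a - k (j + 1) ∨ (n : ℤ) ∣ a - k (j + 1) - 1 := by
    intro _ h3
    apply dvd_of_arc_subset h1 h3
    rw [← ha, ← h.letters_eq _ (by omega) h3, ← hpre (j + 1) (by omega)]
    exact prefixLetters_mono _ (by omega)
  have hdn : 2 ≤ j → (n : ℤ) ∣ k (j - 1) - a ∨ (n : ℤ) ∣ k (j - 1) - a - 1 := by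
    intro h3
    have h4 : j - 1 + 1 = j := by omega
    apply dvd_of_arc_subset (j := j - 1) (by omega) (by omega)
    rw [h4, ← ha, ← h.letters_eq _ (by omega) (by omega), ← hpre (j - 1) (by omega)]
    exact prefixLetters_mono _ (by omega)
  have hdn' := h.isPath (j - 1)
  rw [Nat.sub_add_cancel h1] at hdn'
  rcases Nat.lt_or_ge j 2 with hj | hj
  · rcases Nat.lt_or_ge (j + 1) n with hjn | hjn
    · have hk := h.isPath j h1 hjn
      rcases hup h1 hjn with h3 | h3
      · exact ⟨k (j + 1), h3, by omega, h.isPath.update (by omega) (by omega)⟩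
      · exact ⟨k (j + 1) + 1, by rwa [← sub_sub], by omega,
          h.isPath.update (by omega) (by omega)⟩
    -- There is no neighbouring term: `k 1` is the only coordinate, and `a` is congruent modulo `2`
    -- to `k 1` or `k 1 + 1`.
    · have hn : (n : ℤ) = 2 := by omega
      by_cases h3 : (n : ℤ) ∣ a - k j
      · exact ⟨k j, h3, by omega, h.isPath.update (by omega) (by omega)⟩
      · refine ⟨k j + 1, ?_, by omega, h.isPath.update (by omega) (by omega)⟩
        rw [hn] at h3 ⊢
        omega
  · obtain ⟨b, hab, hb⟩ : ∃ b : ℤ, (n : ℤ) ∣ a - b ∧ (b = k (j - 1) ∨ b = k (j - 1) - 1) := by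
      rcases hdn hj with h3 | h3
      · exact ⟨k (j - 1), by rwa [dvd_sub_comm], Or.inl rfl⟩
      · exact ⟨k (j - 1) - 1, by rwa [dvd_sub_comm, sub_right_comm], Or.inr rfl⟩
    have hdn' := hdn' (by omega) (by omega)
    -- `b` is chosen to fit the left neighbour. It fits the right one modulo `n`; as `n ≥ 4` here
    -- and the differences are at most `2` in absolute value, the congruence is an equality.
    refine ⟨b, hab, by omega, h.isPath.update (fun _ _ => hb) fun _ h3 => ?_⟩
    have hk := h.isPath j h1 h3
    obtain ⟨q, hq⟩ := hab
    rcases hup h1 h3 with ⟨q', h4⟩ | ⟨q', h4⟩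
    · have := eq_zero_of_abs_mul_lt (c := b - k (j + 1)) (q := q' - q)
        (by rw [mul_sub, ← hq, ← h4]; ring) (by omega) (by omega)
      omega
    · have := eq_zero_of_abs_mul_lt (c := b - k (j + 1) - 1) (q := q' - q)
        (by rw [mul_sub, ← hq, ← h4]; ring) (by omega) (by omega)
      omega

/-! ### Walks in `X_n` and the `ℓ¹` distance of lifts. -/

/-- The distance of two lifts. -/
def pathDist (n : ℕ) (k k' : ℕ → ℤ) : ℕ := ∑ j ∈ Ico 1 n, (k j - k' j).natAbs

theorem pathDist_update_add {n : ℕ} (k k' : ℕ → ℤ) {j : ℕ} (h1 : 1 ≤ j) (h2 : j < n) (b : ℤ) :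
    pathDist n (Function.update k j b) k' + (k j - k' j).natAbs =
      pathDist n k k' + (b - k' j).natAbs := by
  have hj : j ∈ Ico 1 n := mem_Ico.2 ⟨h1, h2⟩
  rw [pathDist, pathDist, ← add_sum_erase _ _ hj, ← add_sum_erase _ _ hj]
  rw [Function.update_self, sum_congr rfl (g := fun j => (k j - k' j).natAbs)]
  · ring
  · intro i hi
    rw [Function.update_of_ne (ne_of_mem_erase hi)]

theorem IsPath.exists_raise {n : ℕ} {k k' : ℕ → ℤ} (hk : IsPath n k) (hk' : IsPath n k')
    (h : ∃ i, 1 ≤ i ∧ i < n ∧ k i < k' i) :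
    ∃ j, 1 ≤ j ∧ j < n ∧ k j < k' j ∧ IsPath n (Function.update k j (k j + 1)) := by
  obtain ⟨i, hi1, hi2, hi⟩ := h
  -- The height `2 * k i + i` goes up by one on a flat step and down by one on a descent, so a term
  -- can be raised exactly at a local minimum. A lower neighbour would also lie below `k'`, so the
  -- minimum over the filtered set is a local one.
  obtain ⟨j, hj, hmin⟩ := exists_min_image ((Ico 1 n).filter fun i => k i < k' i)
    (fun i => 2 * k i + i) ⟨i, by simp [hi1, hi2, hi]⟩
  simp only [mem_filter, mem_Ico] at hj hmin
  refine ⟨j, hj.1.1, hj.1.2, hj.2, hk.update (fun h3 _ => ?_) (fun _ h3 => ?_)⟩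
  · have e1 := hk (j - 1) (by omega) (by omega)
    have e2 := hk' (j - 1) (by omega) (by omega)
    have e3 := hmin (j - 1)
    rw [Nat.sub_add_cancel hj.1.1] at e1 e2
    omega
  · have e1 := hk j (by omega) (by omega)
    have e2 := hk' j (by omega) (by omega)
    have e3 := hmin (j + 1)
    omega

theorem IsPath.exists_lower {n : ℕ} {k k' : ℕ → ℤ} (hk : IsPath n k) (hk' : IsPath n k')
    (h : ∃ i, 1 ≤ i ∧ i < n ∧ k' i < k i) :
    ∃ j, 1 ≤ j ∧ j < n ∧ k' j < k j ∧ IsPath n (Function.update k j (k j - 1)) := by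
  obtain ⟨i, hi1, hi2, hi⟩ := h
  obtain ⟨j, hj, hmax⟩ := exists_max_image ((Ico 1 n).filter fun i => k' i < k i)
    (fun i => 2 * k i + i) ⟨i, by simp [hi1, hi2, hi]⟩
  simp only [mem_filter, mem_Ico] at hj hmax
  refine ⟨j, hj.1.1, hj.1.2, hj.2, hk.update (fun h3 _ => ?_) (fun _ h3 => ?_)⟩
  · have e1 := hk (j - 1) (by omega) (by omega)
    have e2 := hk' (j - 1) (by omega) (by omega)
    have e3 := hmax (j - 1)
    rw [Nat.sub_add_cancel hj.1.1] at e1 e2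
    omega
  · have e1 := hk j (by omega) (by omega)
    have e2 := hk' j (by omega) (by omega)
    have e3 := hmax (j + 1)
    omega

/-- As long as the lifts differ, some unit move brings `k` closer to `k'`. The endpoint is produced
by the walk, so this also shows that every path sequence is a lift. -/
theorem IsLift.exists_walk {n : ℕ} {k k' : ℕ → ℤ} (hk' : IsPath n k') (D : ℕ)
    {u : {π : Equiv.Perm (Fin n) // IsArc π}} (hk : IsLift k u.1) (hD : pathDist n k k' = D) :
    ∃ v : {π : Equiv.Perm (Fin n) // IsArc π}, IsLift k' v.1 ∧
      ∃ p : (arcGraph n).Walk u v, p.length = D := by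
  induction D generalizing k u with
  | zero =>
    refine ⟨u, ⟨hk', fun j h1 h2 => ?_⟩, SimpleGraph.Walk.nil, rfl⟩
    have := (sum_eq_zero_iff.1 hD) j (mem_Ico.2 ⟨h1, h2⟩)
    rw [hk.letters_eq j h1 h2, show k j = k' j by omega]
  | succ D ih =>
    obtain ⟨j, b, h1, h2, hb, hbD, hp⟩ : ∃ j, ∃ b : ℤ, 1 ≤ j ∧ j < n ∧
        (b = k j + 1 ∨ b = k j - 1) ∧ (b - k' j).natAbs + 1 = (k j - k' j).natAbs ∧
        IsPath n (Function.update k j b) := by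
      by_cases h : ∃ i, 1 ≤ i ∧ i < n ∧ k i < k' i
      · obtain ⟨j, h1, h2, h3, h4⟩ := hk.isPath.exists_raise hk' h
        exact ⟨j, k j + 1, h1, h2, Or.inl rfl, by omega, h4⟩
      by_cases h' : ∃ i, 1 ≤ i ∧ i < n ∧ k' i < k i
      · obtain ⟨j, h1, h2, h3, h4⟩ := hk.isPath.exists_lower hk' h'
        exact ⟨j, k j - 1, h1, h2, Or.inr rfl, by omega, h4⟩
      exfalso
      have : pathDist n k k' = 0 := by
        refine sum_eq_zero fun i hi => ?_
        rw [mem_Ico] at hi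
        have a1 : ¬ k i < k' i := fun h3 => h ⟨i, hi.1, hi.2, h3⟩
        have a2 : ¬ k' i < k i := fun h3 => h' ⟨i, hi.1, hi.2, h3⟩
        omega
      omega
    have hL := hk.update h1 h2 hb hp
    have hd := pathDist_update_add k k' h1 h2 b
    obtain ⟨v, hv, p, hp⟩ := ih (u := ⟨_, hL.isArc⟩) hL (by omega)
    have hadj : (arcGraph n).Adj u ⟨_, hL.isArc⟩ := (arcGraph_adj_iff _ _).2 ⟨j, h1, h2, rfl⟩
    exact ⟨v, hv, SimpleGraph.Walk.cons hadj p, by rw [SimpleGraph.Walk.length_cons, hp]⟩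

theorem IsLift.exists_lift_of_walk {n : ℕ} {u v : {π : Equiv.Perm (Fin n) // IsArc π}}
    (p : (arcGraph n).Walk u v) {k : ℕ → ℤ} (hk : IsLift k u.1) :
    ∃ k' : ℕ → ℤ, IsLift k' v.1 ∧ pathDist n k k' ≤ p.length := by
  induction p generalizing k with
  | nil => exact ⟨k, hk, by simp [pathDist]⟩
  | @cons u w v h p ih =>
    obtain ⟨j, h1, h2, hw⟩ := (arcGraph_adj_iff _ _).1 h
    obtain ⟨b, hb, hL⟩ := hk.exists_update h1 h2 (hw ▸ w.2)
    obtain ⟨k', hk', hd⟩ := ih (k := Function.update k j b) (hw ▸ hL)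
    refine ⟨k', hk', ?_⟩
    have := pathDist_update_add k k' h1 h2 b
    rw [SimpleGraph.Walk.length_cons]
    omega

/-! ### Lifts of `e` and `w₀`, connectedness and diameter. -/

theorem isLift_one (n : ℕ) : IsLift (fun _ => 0) (1 : Equiv.Perm (Fin n)) where
  isPath _ _ _ := Or.inl rfl
  letters_eq j h1 h2 := by
    ext x
    rw [mem_prefixLetters, mem_arc, emod_of_small (by omega) (by omega)]
    simp only [sub_zero, Nat.cast_nonneg, if_true, Nat.cast_lt]
    exact Iff.rfl

theorem isPath_sub (n : ℕ) (c : ℤ) : IsPath n fun j => c - j := fun j _ _ => by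
  right
  push_cast
  ring

theorem isLift_revPerm (n : ℕ) :
    IsLift (fun j => (n : ℤ) - j) (Fin.revPerm : Equiv.Perm (Fin n)) where
  isPath := isPath_sub n n
  letters_eq j h1 h2 := by
    ext x
    rw [mem_prefixLetters, mem_arc, emod_of_small (by omega) (by omega), Fin.revPerm_symm,
      Fin.revPerm_apply, Fin.val_rev]
    split_ifs <;> omega

theorem isLift_revPerm' (n : ℕ) :
    IsLift (fun j => 0 - (j : ℤ)) (Fin.revPerm : Equiv.Perm (Fin n)) := by
  convert (isLift_revPerm n).add_mul (-1) using 2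
  ring

theorem sum_Ico_id (n : ℕ) : ∑ j ∈ Ico 1 n, j = n.choose 2 := by
  induction n with
  | zero => simp
  | succ n ih =>
    rcases Nat.eq_zero_or_pos n with rfl | hn
    · simp
    · rw [sum_Ico_succ_top hn, ih, Nat.choose_succ_succ' n 1, Nat.choose_one_right, add_comm]

theorem sum_Ico_reflect' {M : Type*} [AddCommMonoid M] (n : ℕ) (f : ℕ → M) :
    ∑ j ∈ Ico 1 n, f (n - j) = ∑ j ∈ Ico 1 n, f j := by
  refine sum_nbij' (fun j => n - j) (fun j => n - j) ?_ ?_ ?_ ?_ ?_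
  · intro j hj; rw [mem_Ico] at hj ⊢; omega
  · intro j hj; rw [mem_Ico] at hj ⊢; omega
  · intro j hj; rw [mem_Ico] at hj; omega
  · intro j hj; rw [mem_Ico] at hj; omega
  · intro j _; rfl

theorem sum_Ico_sub (n : ℕ) : ∑ j ∈ Ico 1 n, (n - j) = n.choose 2 :=
  (sum_Ico_reflect' n fun j => j).trans (sum_Ico_id n)

theorem sum_Ico_const (n : ℕ) : ∑ _j ∈ Ico 1 n, n = 2 * n.choose 2 := by
  rw [two_mul]
  nth_rewrite 1 [← sum_Ico_sub n]
  rw [← sum_Ico_id n, ← sum_add_distrib]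
  refine sum_congr rfl fun j hj => ?_
  rw [mem_Ico] at hj
  omega

/-- Termwise, a lift of `w₀` is at least `n - j` away from `0` if `t ≥ 0` and at least `j` away if
`t < 0`; both bounds sum to `n.choose 2`. -/
theorem pathDist_zero_le (n : ℕ) (t : ℤ) :
    n.choose 2 ≤ pathDist n (fun _ => 0) fun j => (n : ℤ) - j + n * t := by
  rcases le_or_gt 0 t with ht | ht
  · rw [← sum_Ico_sub]
    refine sum_le_sum fun j hj => ?_
    have : 0 ≤ (n : ℤ) * t := by positivity
    dsimp only
    omega
  · rw [← sum_Ico_id]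
    refine sum_le_sum fun j hj => ?_
    have : (n : ℤ) * t ≤ -n := by nlinarith
    rw [mem_Ico] at hj
    dsimp only
    omega

theorem IsPath.exists_pathDist_le {n : ℕ} {k k' : ℕ → ℤ} (hk : IsPath n k) (hk' : IsPath n k') :
    ∃ t : ℤ, pathDist n k (fun j => k' j + n * t) ≤ n.choose 2 := by
  have hd : ∀ j, 1 ≤ j → j + 1 < n →
      (k' (j + 1) - k (j + 1) - (k' j - k j)).natAbs ≤ 1 := by
    intro j h1 h2
    have := hk j h1 h2
    have := hk' j h1 h2
    omega
  set d : ℕ → ℤ := fun j => k' j - k j with hdef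
  by_cases h : ∃ i, 1 ≤ i ∧ i < n ∧ (n : ℤ) ∣ d i
  · obtain ⟨i, hi1, hi2, q, hq⟩ := h
    have hlip : ∀ m j, 1 ≤ j → j + m < n → (d (j + m) - d j).natAbs ≤ m := by
      intro m
      induction m with
      | zero => simp
      | succ m ih =>
        intro j h1 h2
        have := ih j h1 (by omega)
        have := hd (j + m) (by omega) (by omega)
        simp only [hdef, ← add_assoc] at *
        omega
    have hlip' : ∀ j, 1 ≤ j → j < n → (d j - d i).natAbs ≤ ((j : ℤ) - i).natAbs := by
      intro j h1 h2
      rcases le_total i j with hij | hij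
      · have := hlip (j - i) i hi1 (by omega)
        rw [Nat.add_sub_cancel' hij] at this
        omega
      · have := hlip (i - j) j h1 (by omega)
        rw [Nat.add_sub_cancel' hij] at this
        omega
    refine ⟨-q, ?_⟩
    have hle : pathDist n k (fun j => k' j + n * -q) ≤ ∑ j ∈ Ico 1 n, ((j : ℤ) - i).natAbs := by
      refine sum_le_sum fun j hj => ?_
      rw [mem_Ico] at hj
      have := hlip' j hj.1 hj.2
      have h3 : (n : ℤ) * -q = - d i := by rw [hq]; ring
      rw [h3]
      simp only [hdef] at *
      omega
    -- Pairing `j` with `n - j`, the two distances to `i` add up to at most `n`.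
    have h2 : ∑ j ∈ Ico 1 n, ((j : ℤ) - i).natAbs + ∑ j ∈ Ico 1 n, ((j : ℤ) - i).natAbs ≤
        2 * n.choose 2 := by
      nth_rewrite 2 [← sum_Ico_reflect' n fun j => ((j : ℤ) - i).natAbs]
      rw [← sum_add_distrib, ← sum_Ico_const]
      refine sum_le_sum fun j hj => ?_
      rw [mem_Ico] at hj
      omega
    omega
  · push Not at h
    rcases Nat.lt_or_ge 1 n with hn | hn
    swap
    · refine ⟨0, ?_⟩
      rw [pathDist, Ico_eq_empty_of_le hn]
      simp
    set q := d 1 / n with hq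
    -- With steps of size at most one, `d` cannot cross a multiple of `n` without meeting it.
    have hmod : ∀ j, 1 ≤ j → j < n → 0 < d j - n * q ∧ d j - n * q < n := by
      intro j h1
      induction j, h1 using Nat.le_induction with
      | base =>
        intro h2
        have h3 := Int.emod_add_mul_ediv (d 1) n
        have h4 := Int.emod_nonneg (d 1) (b := n) (by omega)
        have h5 := Int.emod_lt_of_pos (d 1) (b := n) (by omega)
        have h6 : d 1 % n ≠ 0 := fun h7 => h 1 le_rfl h2 (Int.dvd_of_emod_eq_zero h7)
        rw [← hq] at h3
        omega
      | succ j h1 ih =>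
        intro h2
        have ih := ih (by omega)
        have h3 := hd j h1 h2
        have h4 : d (j + 1) - n * q ≠ 0 := fun h5 => h (j + 1) (by omega) h2 ⟨q, by linarith⟩
        have h5 : d (j + 1) - n * q ≠ n := fun h5 =>
          h (j + 1) (by omega) h2 ⟨q + 1, by linarith⟩
        simp only [hdef] at *
        omega
    -- The two translates of `k'` enclose `k`, so each term contributes exactly `n`, and one of the
    -- two distances is at most half the total.
    have hsum : pathDist n k (fun j => k' j + n * -q) + pathDist n k (fun j => k' j + n * (-q - 1)) =
        2 * n.choose 2 := by
      rw [pathDist, pathDist, ← sum_add_distrib, ← sum_Ico_const]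
      refine sum_congr rfl fun j hj => ?_
      rw [mem_Ico] at hj
      have h1 := hmod j hj.1 hj.2
      rw [mul_sub, mul_neg]
      simp only [hdef] at *
      omega
    rcases le_total (pathDist n k (fun j => k' j + n * -q)) (n.choose 2) with h1 | h1
    · exact ⟨_, h1⟩
    · exact ⟨-q - 1, by omega⟩

theorem IsLift.exists_walk_to {n : ℕ} {k k' : ℕ → ℤ} {u v : {π : Equiv.Perm (Fin n) // IsArc π}}
    (hk : IsLift k u.1) (hk' : IsLift k' v.1) :
    ∃ p : (arcGraph n).Walk u v, p.length = pathDist n k k' := by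
  obtain ⟨w, hw, p, hp⟩ := hk.exists_walk hk'.isPath _ rfl
  obtain rfl : w = v := Subtype.ext (hw.perm_unique hk' fun _ _ _ => rfl)
  exact ⟨p, hp⟩

theorem exists_walk_le {n : ℕ} (u v : {π : Equiv.Perm (Fin n) // IsArc π}) :
    ∃ p : (arcGraph n).Walk u v, p.length ≤ n.choose 2 := by
  obtain ⟨k, hk⟩ := u.2.exists_lift
  obtain ⟨k', hk'⟩ := v.2.exists_lift
  obtain ⟨t, ht⟩ := hk.isPath.exists_pathDist_le hk'.isPath
  obtain ⟨p, hp⟩ := hk.exists_walk_to (hk'.add_mul t)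
  exact ⟨p, hp.trans_le ht⟩

theorem arcGraph_connected (n : ℕ) : (arcGraph n).Connected :=
  have : Nonempty {π : Equiv.Perm (Fin n) // IsArc π} := ⟨e n⟩
  ⟨fun u v => ⟨(exists_walk_le u v).choose⟩⟩

theorem choose_le_length {n : ℕ} (p : (arcGraph n).Walk (e n) (w₀ n)) :
    n.choose 2 ≤ p.length := by
  obtain ⟨k, hk, hd⟩ := (isLift_one n).exists_lift_of_walk p
  obtain ⟨t, ht⟩ := (isLift_revPerm n).exists_eq_add hk
  refine (pathDist_zero_le n t).trans (le_of_eq_of_le (sum_congr rfl fun j hj => ?_) hd)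
  rw [mem_Ico] at hj
  rw [ht j hj.1 hj.2]

theorem dist_e_w₀ (n : ℕ) : (arcGraph n).dist (e n) (w₀ n) = n.choose 2 := by
  apply le_antisymm
  · obtain ⟨p, hp⟩ := exists_walk_le (e n) (w₀ n)
    exact (SimpleGraph.dist_le p).trans hp
  · obtain ⟨p, hp⟩ := (arcGraph_connected n).exists_walk_length_eq_dist (e n) (w₀ n)
    rw [← hp]
    exact choose_le_length p

theorem diam_arcGraph (n : ℕ) : (arcGraph n).diam = n.choose 2 := by
  have : Nonempty {π : Equiv.Perm (Fin n) // IsArc π} := ⟨e n⟩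
  have htop := SimpleGraph.connected_iff_ediam_ne_top.1 (arcGraph_connected n)
  apply le_antisymm
  · obtain ⟨u, v, h⟩ := (arcGraph n).exists_dist_eq_diam
    obtain ⟨p, hp⟩ := exists_walk_le u v
    rw [← h]
    exact (SimpleGraph.dist_le p).trans hp
  · rw [← dist_e_w₀]
    exact SimpleGraph.dist_le_diam htop

/-! ### Vertices on geodesics from `e` to `w₀`. -/

/-- The lifts between `0` and the sequence `n - 1, n - 2, …`. -/
def IsUpper (n : ℕ) (k : ℕ → ℤ) : Prop := ∀ j, 1 ≤ j → j < n → 0 ≤ k j ∧ k j + j ≤ n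

/-- The lifts between the sequence `-1, -2, …` and `0`. -/
def IsLower (n : ℕ) (k : ℕ → ℤ) : Prop := ∀ j : ℕ, 1 ≤ j → j < n → -(j : ℤ) ≤ k j ∧ k j ≤ 0

theorem mem_geodesicVertices_iff {n : ℕ} (v : {π : Equiv.Perm (Fin n) // IsArc π}) :
    v ∈ geodesicVertices (arcGraph n) (e n) (w₀ n) ↔
      ∃ k, IsLift k v.1 ∧ (IsUpper n k ∨ IsLower n k) := by
  constructor
  · rintro ⟨p, hp, hv⟩
    have hp : p.length = n.choose 2 := Eq.trans hp (dist_e_w₀ n)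
    obtain ⟨q, r, rfl⟩ := SimpleGraph.Walk.mem_support_iff_exists_append.1 hv
    rw [SimpleGraph.Walk.length_append] at hp
    obtain ⟨k, hk, hd⟩ := (isLift_one n).exists_lift_of_walk q
    obtain ⟨k', hk', hd'⟩ := hk.exists_lift_of_walk r
    obtain ⟨t, ht⟩ := (isLift_revPerm n).exists_eq_add hk'
    refine ⟨k, hk, ?_⟩
    have hle : pathDist n (fun _ => 0) k + pathDist n k k' ≤ n.choose 2 := by omega
    rw [pathDist, pathDist, ← sum_add_distrib] at hle
    rcases le_or_gt 0 t with h0 | h0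
    · left
      have h3 : 0 ≤ (n : ℤ) * t := by positivity
      -- These lower bounds already sum to the length of the geodesic, so each is an equality, which
      -- places `k j` between `0` and `n - j`.
      have h4 : ∀ j ∈ Ico 1 n, n - j ≤ (0 - k j).natAbs + (k j - k' j).natAbs := by
        intro j hj
        rw [mem_Ico] at hj
        rw [ht j hj.1 hj.2]
        omega
      rw [← sum_Ico_sub] at hle
      have h5 := (sum_eq_sum_iff_of_le h4).1 (le_antisymm (sum_le_sum h4) hle)
      intro j h1 h2
      have h6 := h5 j (mem_Ico.2 ⟨h1, h2⟩)
      rw [ht j h1 h2] at h6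
      omega
    · right
      have h3 : (n : ℤ) * t ≤ -n := by nlinarith
      have h4 : ∀ j ∈ Ico 1 n, j ≤ (0 - k j).natAbs + (k j - k' j).natAbs := by
        intro j hj
        rw [mem_Ico] at hj
        rw [ht j hj.1 hj.2]
        omega
      rw [← sum_Ico_id] at hle
      have h5 := (sum_eq_sum_iff_of_le h4).1 (le_antisymm (sum_le_sum h4) hle)
      intro j h1 h2
      have h6 := h5 j (mem_Ico.2 ⟨h1, h2⟩)
      rw [ht j h1 h2] at h6
      omega
  · rintro ⟨k, hk, h⟩
    suffices ∃ k', IsLift k' (w₀ n).1 ∧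
        pathDist n (fun _ => 0) k + pathDist n k k' = n.choose 2 by
      obtain ⟨k', hk', hd⟩ := this
      obtain ⟨p, hp⟩ := (isLift_one n).exists_walk_to (u := e n) hk
      obtain ⟨q, hq⟩ := hk.exists_walk_to hk'
      refine ⟨p.append q, ?_, by simp⟩
      change (p.append q).length = _
      rw [SimpleGraph.Walk.length_append, dist_e_w₀]
      omega
    rcases h with h | h
    · refine ⟨_, isLift_revPerm n, ?_⟩
      rw [pathDist, pathDist, ← sum_add_distrib, ← sum_Ico_sub]
      refine sum_congr rfl fun j hj => ?_
      rw [mem_Ico] at hj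
      have := h j hj.1 hj.2
      omega
    · refine ⟨_, isLift_revPerm' n, ?_⟩
      rw [pathDist, pathDist, ← sum_add_distrib, ← sum_Ico_id]
      refine sum_congr rfl fun j hj => ?_
      rw [mem_Ico] at hj
      have := h j hj.1 hj.2
      omega

/-! ### Schur and Thrall's formula and its recurrence. -/

/-- Both sides are minus the coefficient of degree `s.card - 1` in `∏ (X - b i) - ∏ (X - a i)`: by
Lagrange interpolation at the nodes `a i`, where the second product vanishes, and by Vieta. -/
theorem sum_mul_prod_div_eq {ι : Type*} [DecidableEq ι] (s : Finset ι) (a b : ι → ℚ)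
    (ha : Set.InjOn a s) :
    ∑ i ∈ s, (b i - a i) * ∏ j ∈ s.erase i, (a i - b j) / (a i - a j) =
      ∑ i ∈ s, (b i - a i) := by
  rcases s.eq_empty_or_nonempty with rfl | hs
  · simp
  open Polynomial in
  set P : ℚ[X] := ∏ i ∈ s, (X - C (b i)) - ∏ i ∈ s, (X - C (a i)) with hP
  have hdeg : P.degree < s.card := by
    have h1 : (∏ i ∈ s, (Polynomial.X - Polynomial.C (b i))).degree = (s.card : WithBot ℕ) := by
      simp [Polynomial.degree_prod]
    have h2 : (∏ i ∈ s, (Polynomial.X - Polynomial.C (a i))).degree = (s.card : WithBot ℕ) := by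
      simp [Polynomial.degree_prod]
    rw [← h1]
    refine Polynomial.degree_sub_lt_left (h1.trans h2.symm) ?_ ?_
    · exact (Polynomial.monic_prod_of_monic _ _ fun i _ => Polynomial.monic_X_sub_C _).ne_zero
    · rw [(Polynomial.monic_prod_of_monic _ _ fun i _ => Polynomial.monic_X_sub_C _).leadingCoeff,
        (Polynomial.monic_prod_of_monic _ _ fun i _ => Polynomial.monic_X_sub_C _).leadingCoeff]
  have h := Lagrange.coeff_eq_sum ha hdeg
  rw [hP, Polynomial.coeff_sub, Polynomial.prod_X_sub_C_coeff_card_pred _ _ hs.card_pos,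
    Polynomial.prod_X_sub_C_coeff_card_pred _ _ hs.card_pos] at h
  have h' : ∑ i ∈ s, (b i - a i) * ∏ j ∈ s.erase i, (a i - b j) / (a i - a j) =
      -∑ i ∈ s, P.eval (a i) / ∏ j ∈ s.erase i, (a i - a j) := by
    rw [← sum_neg_distrib]
    refine sum_congr rfl fun i hi => ?_
    rw [hP, Polynomial.eval_sub, Polynomial.eval_prod, Polynomial.eval_prod,
      ← mul_prod_erase s _ hi, ← mul_prod_erase s (fun j => Polynomial.eval (a i)
        (Polynomial.X - Polynomial.C (a j))) hi, prod_div_distrib]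
    simp only [Polynomial.eval_sub, Polynomial.eval_X, Polynomial.eval_C, sub_self, zero_mul,
      sub_zero]
    ring
  rw [h', ← hP] at *
  rw [← h, sum_sub_distrib]
  ring

theorem sum_part_mul_prod_eq (S : Finset ℕ) (hS : 0 ∉ S) :
    ∑ s ∈ S, (s : ℚ) * ∏ j ∈ S.erase s,
      (((s : ℚ) - 1 - j) * (s + j)) / ((s - 1 + j) * (s - j)) = ∑ s ∈ S, (s : ℚ) := by
  have hpos : ∀ s ∈ S, 1 ≤ s := fun s hs => Nat.one_le_iff_ne_zero.2 fun h => hS (h ▸ hs)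
  -- With this choice `a s - b j = (s - 1 - j) (s + j)` and `a s - a j = (s - 1 + j) (s - j)`. The
  -- nodes are distinct only because `0 ∉ S`: parts `0` and `1` would share the node `0`.
  have h := sum_mul_prod_div_eq S (fun s => (s : ℚ) * (s - 1)) (fun s => (s : ℚ) * (s + 1)) (by
    intro x hx y hy hxy
    have hx := hpos x hx
    have hy := hpos y hy
    have h1 : ((x : ℚ) - y) * (x + y - 1) = 0 := by
      simp only at hxy
      linear_combination hxy
    have hx' : (1 : ℚ) ≤ x := by exact_mod_cast hx
    have hy' : (1 : ℚ) ≤ y := by exact_mod_cast hy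
    have h2 : (x : ℚ) + y - 1 ≠ 0 := by linarith
    have h3 := (mul_eq_zero.1 h1).resolve_right h2
    exact_mod_cast sub_eq_zero.1 h3)
  have e : ∀ s : ℕ, (s : ℚ) * (s + 1) - s * (s - 1) = 2 * s := fun s => by ring
  simp only [e, mul_assoc, ← mul_sum] at h
  refine (sum_congr rfl fun s _ => ?_).trans (mul_left_cancel₀ two_ne_zero h)
  congr 1
  refine prod_congr rfl fun j _ => ?_
  congr 1 <;> ring

/-- The factor of the pair of parts `i < j` in the formula for shifted tableaux. -/
def pairFactor (i j : ℕ) : ℚ := if i < j then ((j : ℚ) - i) / (j + i) else 1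

/-- Schur and Thrall's formula for the number of standard tableaux of the shifted shape with the
set of parts `S`, divided by the factorial of the size of the shape. -/
def shiftedWeight (S : Finset ℕ) : ℚ :=
  (∏ s ∈ S, (s.factorial : ℚ)⁻¹) * ∏ j ∈ S, ∏ i ∈ S, pairFactor i j

/-- Schur and Thrall's formula for the number of standard tableaux of the shifted shape with the
set of parts `S`. -/
def shiftedCount (S : Finset ℕ) : ℚ := ((∑ s ∈ S, s).factorial : ℚ) * shiftedWeight S

theorem shiftedWeight_insert {x : ℕ} {R : Finset ℕ} (hx : x ∉ R) :
    shiftedWeight (insert x R) = shiftedWeight R * (x.factorial : ℚ)⁻¹ *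
      ∏ j ∈ R, (pairFactor x j * pairFactor j x) := by
  have h1 : pairFactor x x = 1 := by simp [pairFactor]
  rw [shiftedWeight, shiftedWeight, prod_insert hx, prod_insert hx, prod_insert hx, h1]
  simp only [prod_insert hx, prod_mul_distrib]
  ring

theorem shiftedWeight_insert_zero {R : Finset ℕ} (hR : 0 ∉ R) :
    shiftedWeight (insert 0 R) = shiftedWeight R := by
  rw [shiftedWeight_insert hR, prod_eq_one]
  · simp
  · intro j hj
    have : j ≠ 0 := fun h => hR (h ▸ hj)
    have h0 : 0 < j := by omega
    simp [pairFactor, this, h0]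

theorem shiftedCount_erase_zero (S : Finset ℕ) : shiftedCount (S.erase 0) = shiftedCount S := by
  by_cases h : 0 ∈ S
  · conv_rhs => rw [← insert_erase h]
    rw [shiftedCount, shiftedCount, shiftedWeight_insert_zero (notMem_erase 0 S),
      sum_insert (notMem_erase 0 S), zero_add]
  · rw [erase_eq_of_notMem h]

theorem pairFactor_pred {s j : ℕ} (hs : 1 ≤ s) (hj : 1 ≤ j) (h1 : j ≠ s) (h2 : j ≠ s - 1) :
    pairFactor (s - 1) j * pairFactor j (s - 1) = pairFactor s j * pairFactor j s *
      ((((s : ℚ) - 1 - j) * (s + j)) / ((s - 1 + j) * (s - j))) := by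
  have hs' : (1 : ℚ) ≤ s := by exact_mod_cast hs
  have hj' : (1 : ℚ) ≤ j := by exact_mod_cast hj
  have e1 : (s : ℚ) + j ≠ 0 := by linarith
  have e2 : (s : ℚ) - 1 + j ≠ 0 := by linarith
  have e1' : (j : ℚ) + s ≠ 0 := by linarith
  have e2' : (j : ℚ) + (s - 1) ≠ 0 := by linarith
  have e3 : (s : ℚ) - j ≠ 0 := by
    rw [sub_ne_zero]
    exact_mod_cast h1.symm
  simp only [pairFactor]
  rcases Nat.lt_or_gt_of_ne h1 with h3 | h3
  · rw [if_neg (by omega), if_pos (by omega), if_neg (by omega), if_pos (by omega)]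
    push_cast [hs]
    field_simp
  · rw [if_pos (by omega), if_neg (by omega), if_pos (by omega), if_neg (by omega)]
    push_cast [hs]
    field_simp
    ring

theorem shiftedCount_lower {S : Finset ℕ} (hS : 0 ∉ S) {s : ℕ} (hs : s ∈ S) (hs' : s - 1 ∉ S) :
    shiftedCount (insert (s - 1) (S.erase s)) * (∑ s ∈ S, (s : ℚ)) =
      shiftedCount S * (s * ∏ j ∈ S.erase s,
        (((s : ℚ) - 1 - j) * (s + j)) / ((s - 1 + j) * (s - j))) := by
  have hs1 : 1 ≤ s := Nat.one_le_iff_ne_zero.2 fun h => hS (h ▸ hs)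
  have hs2 : s - 1 ∉ S.erase s := fun h => hs' (mem_of_mem_erase h)
  have hins := insert_erase hs
  set R := S.erase s with hR
  have hsR : s ∉ R := notMem_erase s S
  have hprod : ∏ j ∈ R, (pairFactor (s - 1) j * pairFactor j (s - 1)) =
      (∏ j ∈ R, (pairFactor s j * pairFactor j s)) *
        ∏ j ∈ R, (((s : ℚ) - 1 - j) * (s + j)) / ((s - 1 + j) * (s - j)) := by
    rw [← prod_mul_distrib]
    refine prod_congr rfl fun j hj => pairFactor_pred hs1 ?_ ?_ ?_
    · exact Nat.one_le_iff_ne_zero.2 fun h => hS (h ▸ mem_of_mem_erase hj)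
    · exact ne_of_mem_erase hj
    · exact fun h => hs2 (h ▸ hj)
  rw [← hins, ← Nat.cast_sum, shiftedCount, shiftedCount, shiftedWeight_insert hs2,
    shiftedWeight_insert hsR, sum_insert hs2, sum_insert hsR, hprod]
  obtain ⟨s, rfl⟩ : ∃ t, s = t + 1 := ⟨s - 1, by omega⟩
  rw [show s + 1 + ∑ x ∈ R, x = (s + ∑ x ∈ R, x) + 1 by ring, Nat.factorial_succ,
    Nat.factorial_succ, Nat.add_sub_cancel]
  have h1 : ((s.factorial : ℕ) : ℚ) ≠ 0 := by exact_mod_cast s.factorial_ne_zero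
  have h2 : ((s : ℕ) : ℚ) + 1 ≠ 0 := by positivity
  push_cast
  field_simp

/-- The formula of Schur and Thrall satisfies the recurrence of removing a box. -/
theorem shiftedCount_eq_sum {S : Finset ℕ} (hS : 0 ∉ S) (hne : S.Nonempty) :
    shiftedCount S = ∑ s ∈ S.filter (fun s => s - 1 ∉ S),
      shiftedCount ((insert (s - 1) (S.erase s)).erase 0) := by
  have hpos : ∀ s ∈ S, 1 ≤ s := fun s hs => Nat.one_le_iff_ne_zero.2 fun h => hS (h ▸ hs)
  have hN : (∑ s ∈ S, (s : ℚ)) ≠ 0 := by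
    rw [← Nat.cast_sum, Nat.cast_ne_zero]
    have : 0 < ∑ s ∈ S, s := sum_pos (fun s hs => hpos s hs) hne
    omega
  refine mul_right_cancel₀ hN ?_
  rw [sum_mul]
  conv_lhs => rw [← sum_part_mul_prod_eq S hS, mul_sum]
  rw [sum_filter]
  refine sum_congr rfl fun s hs => ?_
  split_ifs with h
  · have h1 := hpos s hs
    -- A part `s` with `s - 1 ∈ S` cannot be shortened; the factor at `j = s - 1` vanishes
    -- accordingly.
    rw [prod_eq_zero (i := s - 1), mul_zero, mul_zero]
    · exact mem_erase.2 ⟨by omega, h⟩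
    · push_cast [h1]
      simp
  · rw [shiftedCount_erase_zero, shiftedCount_lower hS hs h]

theorem prod_Ico_add (n m : ℕ) :
    (n.factorial : ℚ) * ∏ i ∈ Ico 1 (m + 1), ((n : ℚ) + i) = (n + m).factorial := by
  induction m with
  | zero => simp
  | succ m ih =>
    rw [prod_Ico_succ_top (by omega), ← mul_assoc, ih, ← add_assoc, Nat.factorial_succ]
    push_cast
    ring

theorem prod_Ico_sub (n : ℕ) :
    ∏ i ∈ Ico 1 (n + 1), (((n + 1 : ℕ) : ℚ) - i) = n.factorial := by
  rw [← prod_Ico_id_eq_factorial, Nat.cast_prod]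
  have := sum_Ico_reflect' (M := Additive ℚ) (n + 1) fun i => Additive.ofMul (i : ℚ)
  refine Eq.trans (prod_congr rfl fun i hi => ?_) this
  rw [mem_Ico] at hi
  change _ = (((n + 1 - i : ℕ)) : ℚ)
  push_cast [hi.2.le]
  rfl

theorem shiftedWeight_Ico (n : ℕ) : shiftedWeight (Ico 1 (n + 1)) =
    ∏ i ∈ range n, (i.factorial : ℚ) / ((2 * i + 1).factorial : ℚ) := by
  induction n with
  | zero => simp [shiftedWeight]
  | succ n ih =>
    rw [← insert_Ico_right_eq_Ico_add_one (by omega), shiftedWeight_insert (by simp), ih,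
      prod_range_succ, mul_assoc]
    congr 1
    have h1 : ∏ j ∈ Ico 1 (n + 1), (pairFactor (n + 1) j * pairFactor j (n + 1)) =
        (∏ j ∈ Ico 1 (n + 1), (((n + 1 : ℕ) : ℚ) - j)) /
          ∏ j ∈ Ico 1 (n + 1), (((n + 1 : ℕ) : ℚ) + j) := by
      rw [← prod_div_distrib]
      refine prod_congr rfl fun j hj => ?_
      rw [mem_Ico] at hj
      rw [pairFactor, pairFactor, if_neg (by omega), if_pos (by omega), one_mul]
    have h2 := prod_Ico_add (n + 1) n
    rw [h1, prod_Ico_sub, show 2 * n + 1 = n + 1 + n by ring, ← h2]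
    have h3 : (((n + 1).factorial : ℕ) : ℚ) ≠ 0 := by exact_mod_cast (n + 1).factorial_ne_zero
    field_simp

theorem shiftedCount_Ico {n : ℕ} (hn : 1 ≤ n) : shiftedCount (Ico 1 n) =
    ((n.choose 2).factorial : ℚ) *
      ∏ i ∈ range (n - 1), (i.factorial : ℚ) / ((2 * i + 1).factorial : ℚ) := by
  obtain ⟨n, rfl⟩ : ∃ m, n = m + 1 := ⟨n - 1, by omega⟩
  rw [shiftedCount, sum_Ico_id, shiftedWeight_Ico, Nat.add_sub_cancel]

/-! ### Conjugation by `w₀` and unimodality. -/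

/-- The conjugate of a permutation by the longest element. -/
def conj {n : ℕ} (π : Equiv.Perm (Fin n)) : Equiv.Perm (Fin n) :=
  Fin.revPerm * π * Fin.revPerm

theorem conj_symm_apply {n : ℕ} (π : Equiv.Perm (Fin n)) (x : Fin n) :
    (conj π).symm x = (π.symm x.rev).rev := by
  rw [Equiv.symm_apply_eq]
  simp [conj]

theorem revPerm_mul_self (n : ℕ) : (Fin.revPerm : Equiv.Perm (Fin n)) * Fin.revPerm = 1 := by
  ext x
  simp

theorem conj_conj {n : ℕ} (π : Equiv.Perm (Fin n)) : conj (conj π) = π := by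
  ext x
  simp [conj]

theorem conj_mul {n : ℕ} (π σ : Equiv.Perm (Fin n)) : conj (π * σ) = conj π * conj σ := by
  ext x
  simp [conj]

theorem conj_simpleSwap {n j : ℕ} (h1 : 1 ≤ j) (h2 : j < n) :
    conj (simpleSwap j h1 h2) = simpleSwap (n - j) (by omega) (by omega) := by
  have hinv : (Fin.revPerm : Equiv.Perm (Fin n))⁻¹ = Fin.revPerm :=
    inv_eq_of_mul_eq_one_left (revPerm_mul_self n)
  rw [conj, simpleSwap, simpleSwap]
  nth_rewrite 2 [← hinv]
  rw [← Equiv.swap_apply_apply, Equiv.swap_comm]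
  congr 1
  all_goals
    ext
    simp only [Fin.revPerm_apply, Fin.val_rev]
    omega

/-- A prefix of the conjugate is the reversal of a suffix of `π`, that is, of the complement of the
arc of length `n - j` from `k (n - j)`. -/
theorem IsLift.conj {n : ℕ} {k : ℕ → ℤ} {π : Equiv.Perm (Fin n)} (h : IsLift k π) :
    IsLift (fun j => -k (n - j)) (conj π) where
  isPath j h1 h2 := by
    have := h.isPath (n - (j + 1)) (by omega) (by omega)
    rw [show n - (j + 1) + 1 = n - j by omega] at this
    dsimp only
    omega
  letters_eq j h1 h2 := by
    ext x
    have h3 := h.mem_prefixLetters_iff (j := n - j) (by omega) (fun _ _ => rfl) x.rev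
    rw [mem_prefixLetters, mem_arc] at h3
    rw [mem_prefixLetters, mem_arc, conj_symm_apply]
    have r0 := Int.emod_nonneg ((x : ℤ) + k (n - j)) (b := n) (by omega)
    have r1 := Int.emod_lt_of_pos ((x : ℤ) + k (n - j)) (b := n) (by omega)
    have h4 : ((x.rev : ℕ) - k (n - j) : ℤ) % n = n - 1 - ((x : ℤ) + k (n - j)) % n := by
      have h5 : ((x.rev : ℕ) - k (n - j) : ℤ) = n - 1 - (x + k (n - j)) := by
        rw [Fin.val_rev]
        omega
      rw [h5, ← Int.sub_emod_emod, Int.emod_eq_of_lt (by omega) (by omega)]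
    rw [h4] at h3
    rw [sub_neg_eq_add, Fin.val_rev]
    omega

/-- Conjugation by the longest element, on the vertices of `X_n`. -/
def conjVertex {n : ℕ} (v : {π : Equiv.Perm (Fin n) // IsArc π}) :
    {π : Equiv.Perm (Fin n) // IsArc π} :=
  ⟨conj v.1, v.2.exists_lift.choose_spec.conj.isArc⟩

theorem conjVertex_involutive (n : ℕ) :
    Function.Involutive (conjVertex : {π : Equiv.Perm (Fin n) // IsArc π} → _) :=
  fun v => Subtype.ext (conj_conj v.1)

theorem conjVertex_e (n : ℕ) : conjVertex (e n) = e n :=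
  Subtype.ext (by change conj 1 = 1; rw [conj, mul_one, revPerm_mul_self])

theorem conjVertex_w₀ (n : ℕ) : conjVertex (w₀ n) = w₀ n :=
  Subtype.ext
    (by change conj Fin.revPerm = Fin.revPerm; rw [conj, revPerm_mul_self, one_mul])

theorem adj_conjVertex {n : ℕ} {u v : {π : Equiv.Perm (Fin n) // IsArc π}}
    (h : (arcGraph n).Adj u v) : (arcGraph n).Adj (conjVertex u) (conjVertex v) := by
  obtain ⟨j, h1, h2, hv⟩ := (arcGraph_adj_iff _ _).1 h
  refine (arcGraph_adj_iff _ _).2 ⟨n - j, by omega, by omega, ?_⟩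
  change conj v.1 = conj u.1 * _
  rw [hv, conj_mul, conj_simpleSwap]

theorem IsUpper.conj {n : ℕ} {k : ℕ → ℤ} (h : IsUpper n k) : IsLower n fun j => -k (n - j) := by
  intro j h1 h2
  have := h (n - j) (by omega) (by omega)
  dsimp only
  omega

theorem IsLower.conj {n : ℕ} {k : ℕ → ℤ} (h : IsLower n k) : IsUpper n fun j => -k (n - j) := by
  intro j h1 h2
  have := h (n - j) (by omega) (by omega)
  dsimp only
  omega

/-- An arc is an interval when its start has a representative in `[0, n - j]`. Such representatives
differ by less than `n`, so the step condition modulo `n` holds in `ℤ`. -/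
theorem forall_isInterval_prefixLetters_iff {n : ℕ} {π : Equiv.Perm (Fin n)} :
    (∀ j : ℕ, 1 ≤ j → j ≤ n → IsInterval (prefixLetters π j)) ↔
      ∃ k, IsLift k π ∧ IsUpper n k := by
  constructor
  · intro h
    have h1 : ∀ j, ∃ a : ℤ, 1 ≤ j → j < n →
        prefixLetters π j = arc n a j ∧ 0 ≤ a ∧ a + j ≤ n := by
      intro j
      by_cases hj : 1 ≤ j ∧ j < n
      · obtain ⟨a, b, hab, hs⟩ := h j hj.1 hj.2.le
        have hc := card_prefixLetters π hj.2.le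
        rw [hs, Fin.card_Icc] at hc
        rw [Fin.le_def] at hab
        refine ⟨(a : ℕ), fun _ _ => ⟨?_, by omega, by omega⟩⟩
        rw [hs, arc_eq_Icc a b (by omega)]
      · exact ⟨0, fun h1 h2 => absurd ⟨h1, h2⟩ hj⟩
    choose a ha using h1
    refine ⟨a, ⟨fun j h1 h2 => ?_, fun j h1 h2 => (ha j h1 h2).1⟩, fun j h1 h2 => (ha j h1 h2).2⟩
    obtain ⟨e1, e2, e3⟩ := ha j h1 (by omega)
    obtain ⟨f1, f2, f3⟩ := ha (j + 1) (by omega) h2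
    push_cast at f3
    rcases dvd_of_arc_subset (a := a j) (b := a (j + 1)) h1 h2
      (by rw [← e1, ← f1]; exact prefixLetters_mono π (by omega)) with ⟨q, hq⟩ | ⟨q, hq⟩
    · have := eq_zero_of_abs_mul_lt hq (by omega) (by omega)
      omega
    · have := eq_zero_of_abs_mul_lt hq (by omega) (by omega)
      omega
  · rintro ⟨k, hk, h⟩ j h1 h2
    rcases h2.lt_or_eq with h2 | rfl
    · obtain ⟨h3, h4⟩ := h j h1 h2
      rw [hk.letters_eq j h1 h2]
      obtain ⟨a, ha⟩ := Int.eq_ofNat_of_zero_le h3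
      have hI := arc_eq_Icc (n := n) (j := j) ⟨a, by omega⟩ ⟨a + j - 1, by omega⟩
        (by dsimp only; omega)
      rw [ha]
      exact ⟨_, _, by rw [Fin.le_def]; dsimp only; omega, hI⟩
    · refine ⟨⟨0, by omega⟩, ⟨j - 1, by omega⟩, by rw [Fin.le_def]; dsimp only; omega, ?_⟩
      ext x
      rw [mem_prefixLetters, mem_Icc, Fin.le_def, Fin.le_def]
      dsimp only
      omega

theorem IsInterval.map_rev {n : ℕ} {s t : Finset (Fin n)} (h : IsInterval s)
    (hst : ∀ x, x ∈ t ↔ x.rev ∈ s) : IsInterval t := by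
  obtain ⟨a, b, hab, rfl⟩ := h
  refine ⟨b.rev, a.rev, Fin.rev_le_rev.2 hab, ?_⟩
  ext x
  rw [hst, mem_Icc, mem_Icc]
  simp only [Fin.le_def, Fin.val_rev]
  omega

theorem forall_isInterval_suffixLetters_iff {n : ℕ} {π : Equiv.Perm (Fin n)} :
    (∀ j : ℕ, 1 ≤ j → j ≤ n → IsInterval (suffixLetters π j)) ↔
      ∃ k, IsLift k π ∧ IsLower n k := by
  have h1 : (∀ j : ℕ, 1 ≤ j → j ≤ n → IsInterval (suffixLetters π j)) ↔
      ∀ j : ℕ, 1 ≤ j → j ≤ n → IsInterval (prefixLetters (conj π) j) := by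
    have hmem : ∀ j x, x ∈ prefixLetters (conj π) j ↔ x.rev ∈ suffixLetters π j := by
      intro j x
      rw [mem_prefixLetters, mem_suffixLetters, conj_symm_apply, Fin.val_rev]
      omega
    refine forall_congr' fun j => forall_congr' fun _ => forall_congr' fun _ => ⟨?_, ?_⟩
    · exact fun h => h.map_rev (hmem j)
    · exact fun h => h.map_rev fun x => by rw [hmem, Fin.rev_rev]
  rw [h1, forall_isInterval_prefixLetters_iff]
  constructor
  · rintro ⟨k, hk, h⟩
    exact ⟨_, by simpa only [conj_conj] using hk.conj, h.conj⟩
  · rintro ⟨k, hk, h⟩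
    exact ⟨_, hk.conj, h.conj⟩

theorem isUnimodal_iff {n : ℕ} {π : Equiv.Perm (Fin n)} :
    IsUnimodal π ↔ ∃ k, IsLift k π ∧ (IsUpper n k ∨ IsLower n k) := by
  rw [IsUnimodal, forall_isInterval_prefixLetters_iff, forall_isInterval_suffixLetters_iff,
    ← exists_or]
  exact exists_congr fun k => (and_or_left).symm

/-! ### Shifted shapes and the number of unimodal permutations. -/

/-- The column lengths of the shifted shape with the set of parts `S`. -/
def columns (S : Finset ℕ) (j : ℕ) : ℤ := (S.filter (j ≤ ·)).card

theorem columns_succ (S : Finset ℕ) (j : ℕ) :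
    columns S j = columns S (j + 1) + if j ∈ S then 1 else 0 := by
  rw [columns, columns]
  split_ifs with h
  · have : S.filter (j ≤ ·) = insert j (S.filter (j + 1 ≤ ·)) := by
      ext i
      simp only [mem_filter, mem_insert]
      constructor
      · rintro ⟨h1, h2⟩
        rcases h2.eq_or_lt with h3 | h3
        · exact Or.inl h3.symm
        · exact Or.inr ⟨h1, h3⟩
      · rintro (rfl | ⟨h1, h2⟩)
        · exact ⟨h, le_rfl⟩
        · exact ⟨h1, by omega⟩
    rw [this, card_insert_of_notMem (by simp)]
    push_cast
    rfl
  · rw [add_zero]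
    congr 2
    ext i
    simp only [mem_filter, and_congr_right_iff]
    intro hi
    have : i ≠ j := fun h' => h (h' ▸ hi)
    omega

theorem isPath_columns (n : ℕ) (S : Finset ℕ) : IsPath n (columns S) := by
  intro j _ _
  have := columns_succ S j
  split_ifs at this <;> omega

theorem columns_eq_zero {n : ℕ} {S : Finset ℕ} (hS : S ⊆ Ico 1 n) {j : ℕ} (hj : n ≤ j) :
    columns S j = 0 := by
  rw [columns, Nat.cast_eq_zero, card_eq_zero, filter_eq_empty_iff]
  intro i hi
  have := mem_Ico.1 (hS hi)
  omega

theorem isUpper_columns {n : ℕ} {S : Finset ℕ} (hS : S ⊆ Ico 1 n) : IsUpper n (columns S) := by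
  intro j h1 h2
  refine ⟨by simp [columns], ?_⟩
  have : (S.filter (j ≤ ·)).card ≤ (Ico j n).card := by
    apply card_le_card
    intro i hi
    rw [mem_filter] at hi
    have := mem_Ico.1 (hS hi.1)
    exact mem_Ico.2 ⟨hi.2, this.2⟩
  rw [Nat.card_Ico] at this
  rw [columns]
  omega

theorem pathDist_columns {n : ℕ} {S : Finset ℕ} (hS : S ⊆ Ico 1 n) :
    pathDist n (columns S) (fun _ => 0) = ∑ s ∈ S, s := by
  have h1 : ∀ j, (columns S j - 0).natAbs = ∑ s ∈ S, if j ≤ s then 1 else 0 := by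
    intro j
    rw [columns, card_filter, sub_zero, Int.natAbs_natCast]
  simp only [pathDist, h1]
  rw [sum_comm]
  refine sum_congr rfl fun s hs => ?_
  have := mem_Ico.1 (hS hs)
  rw [← card_filter]
  have h2 : (Ico 1 n).filter (· ≤ s) = Ico 1 (s + 1) := by
    ext i
    simp only [mem_filter, mem_Ico]
    omega
  rw [h2, Nat.card_Ico, Nat.add_sub_cancel]

theorem columns_injOn {n : ℕ} {S T : Finset ℕ} (hS : S ⊆ Ico 1 n) (hT : T ⊆ Ico 1 n)
    (h : ∀ j, 1 ≤ j → j < n → columns S j = columns T j) : S = T := by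
  have h' : ∀ j, 1 ≤ j → columns S j = columns T j := by
    intro j h1
    rcases Nat.lt_or_ge j n with h2 | h2
    · exact h j h1 h2
    · rw [columns_eq_zero hS h2, columns_eq_zero hT h2]
  ext j
  rcases Nat.eq_zero_or_pos j with rfl | hj
  · exact ⟨fun h0 => absurd (mem_Ico.1 (hS h0)).1 (by omega),
      fun h0 => absurd (mem_Ico.1 (hT h0)).1 (by omega)⟩
  · have h1 := columns_succ S j
    have h2 := columns_succ T j
    rw [h' j hj, h' (j + 1) (by omega)] at h1
    split_ifs at h1 h2 with h3 h4 h4 <;> first | omega | simp [h3, h4]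

theorem IsUpper.exists_columns {n : ℕ} {k : ℕ → ℤ} (hk : IsPath n k) (h : IsUpper n k) :
    ∃ S ⊆ Ico 1 n, ∀ j, 1 ≤ j → j < n → k j = columns S j := by
  -- Extending by `0` from index `n` on keeps the last step legitimate, as `k (n - 1)` is `0` or
  -- `1`. The parts are then the positions of the descents.
  set k' : ℕ → ℤ := fun j => if j < n then k j else 0 with hk'
  set S := (Ico 1 n).filter (fun j => k' (j + 1) ≠ k' j) with hSdef
  have hS : S ⊆ Ico 1 n := filter_subset _ _
  have hstep : ∀ j, 1 ≤ j → j < n → k' j = k' (j + 1) + if j ∈ S then 1 else 0 := by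
    intro j h1 h2
    have hmem : j ∈ S ↔ k' (j + 1) ≠ k' j := by simp [hSdef, h1, h2]
    simp only [hmem]
    simp only [hk', if_pos h2]
    by_cases h3 : j + 1 < n
    · have := hk j h1 h3
      rw [if_pos h3]
      split_ifs <;> omega
    · have := h j h1 h2
      rw [if_neg h3]
      split_ifs <;> omega
  have key : ∀ m j, 1 ≤ j → n ≤ j + m → k' j = columns S j := by
    intro m
    induction m with
    | zero =>
      intro j h1 h2
      rw [columns_eq_zero hS (j := j) h2, hk']
      exact if_neg (by omega)
    | succ m ih =>
      intro j h1 h2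
      by_cases h3 : j < n
      · rw [hstep j h1 h3, columns_succ S j, ih (j + 1) (by omega) (by omega)]
      · exact ih j h1 (by omega)
  refine ⟨S, hS, fun j h1 h2 => ?_⟩
  rw [← key n j h1 (by omega), hk']
  exact (if_pos h2).symm

theorem exists_isLift {n : ℕ} {k : ℕ → ℤ} (hk : IsPath n k) :
    ∃ v : {π : Equiv.Perm (Fin n) // IsArc π}, IsLift k v.1 := by
  obtain ⟨v, hv, -⟩ := (isLift_one n).exists_walk (u := e n) hk _ rfl
  exact ⟨v, hv⟩

/-- The arc permutation encoded by a shifted shape. -/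
noncomputable def ofParts (n : ℕ) (S : Finset ℕ) : {π : Equiv.Perm (Fin n) // IsArc π} :=
  (exists_isLift (isPath_columns n S)).choose

theorem isLift_ofParts (n : ℕ) (S : Finset ℕ) : IsLift (columns S) (ofParts n S).1 :=
  (exists_isLift (isPath_columns n S)).choose_spec

theorem IsUpper.eq_of_isLift {n : ℕ} {k k' : ℕ → ℤ} {π : Equiv.Perm (Fin n)} (hk : IsLift k π)
    (hk' : IsLift k' π) (h : IsUpper n k) (h' : IsUpper n k') {j : ℕ} (h1 : 1 ≤ j) (h2 : j < n) :
    k j = k' j := by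
  obtain ⟨t, ht⟩ := hk.exists_eq_add hk'
  have h3 := ht j h1 h2
  have h4 := h j h1 h2
  have h5 := h' j h1 h2
  have := eq_zero_of_abs_mul_lt (n := n) (c := k' j - k j) (q := t) (by rw [h3]; ring)
    (by omega) (by omega)
  omega

theorem ofParts_injOn {n : ℕ} {S T : Finset ℕ} (hS : S ⊆ Ico 1 n) (hT : T ⊆ Ico 1 n)
    (h : ofParts n S = ofParts n T) : S = T :=
  columns_injOn hS hT fun _ h1 h2 => IsUpper.eq_of_isLift (isLift_ofParts n S)
    (by rw [h]; exact isLift_ofParts n T) (isUpper_columns hS) (isUpper_columns hT) h1 h2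

theorem eq_ofParts {n : ℕ} {k : ℕ → ℤ} {v : {π : Equiv.Perm (Fin n) // IsArc π}} {S : Finset ℕ}
    (hk : IsLift k v.1) (h : ∀ j, 1 ≤ j → j < n → k j = columns S j) : v = ofParts n S :=
  Subtype.ext (hk.perm_unique (isLift_ofParts n S) h)

theorem ofParts_empty (n : ℕ) : ofParts n ∅ = e n :=
  (eq_ofParts (v := e n) (isLift_one n) fun j _ _ => by simp [columns]).symm

theorem ofParts_Ico (n : ℕ) : ofParts n (Ico 1 n) = w₀ n := by
  refine (eq_ofParts (v := w₀ n) (isLift_revPerm n) fun j h1 h2 => ?_).symm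
  have : (Ico 1 n).filter (j ≤ ·) = Ico j n := by
    ext i
    simp only [mem_filter, mem_Ico]
    omega
  rw [columns, this, Nat.card_Ico]
  omega

/-- With `k' = k + n t`, the bounds squeeze `k` to `0` if `t ≥ 0` and to `n - j` if `t < 0`. -/
theorem eq_e_or_eq_w₀ {n : ℕ} {k k' : ℕ → ℤ} {v : {π : Equiv.Perm (Fin n) // IsArc π}}
    (hk : IsLift k v.1) (hk' : IsLift k' v.1) (h : IsUpper n k) (h' : IsLower n k') :
    v = e n ∨ v = w₀ n := by
  obtain ⟨t, ht⟩ := hk.exists_eq_add hk'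
  rcases le_or_gt 0 t with h0 | h0
  · left
    have h3 : 0 ≤ (n : ℤ) * t := by positivity
    refine Subtype.ext (hk.perm_unique (isLift_one n) fun j h1 h2 => ?_)
    have := ht j h1 h2
    have := h j h1 h2
    have := h' j h1 h2
    omega
  · right
    have h3 : (n : ℤ) * t ≤ -n := by nlinarith
    refine Subtype.ext (hk.perm_unique (isLift_revPerm n) fun j h1 h2 => ?_)
    have := ht j h1 h2
    have := h j h1 h2
    have := h' j h1 h2
    omega

theorem e_ne_w₀ {n : ℕ} (hn : 2 ≤ n) : e n ≠ w₀ n := by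
  rw [← ofParts_empty, ← ofParts_Ico]
  intro h
  have := ofParts_injOn (empty_subset _) (le_refl _) h
  have h1 : 1 ∈ Ico 1 n := mem_Ico.2 ⟨le_rfl, by omega⟩
  rw [← this] at h1
  exact absurd h1 (notMem_empty _)

theorem ncard_geodesicVertices {n : ℕ} (hn : 2 ≤ n) :
    (geodesicVertices (arcGraph n) (e n) (w₀ n)).ncard = 2 ^ n - 2 := by
  set A : Set {π : Equiv.Perm (Fin n) // IsArc π} := {v | ∃ k, IsLift k v.1 ∧ IsUpper n k} with hA
  set B : Set {π : Equiv.Perm (Fin n) // IsArc π} := {v | ∃ k, IsLift k v.1 ∧ IsLower n k} with hB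
  have hAB : geodesicVertices (arcGraph n) (e n) (w₀ n) = A ∪ B := by
    ext v
    rw [mem_geodesicVertices_iff, hA, hB, Set.mem_union, Set.mem_ofPred_eq, Set.mem_ofPred_eq,
      ← exists_or]
    exact exists_congr fun k => and_or_left
  have hA' : A = ofParts n '' ((Ico 1 n).powerset : Set (Finset ℕ)) := by
    ext v
    rw [Set.mem_image]
    constructor
    · rintro ⟨k, hk, h⟩
      obtain ⟨S, hS, hkS⟩ := h.exists_columns hk.isPath
      exact ⟨S, mem_coe.2 (mem_powerset.2 hS), (eq_ofParts hk hkS).symm⟩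
    · rintro ⟨S, hS, rfl⟩
      exact ⟨_, isLift_ofParts n S, isUpper_columns (mem_powerset.1 (mem_coe.1 hS))⟩
  have hAcard : A.ncard = 2 ^ (n - 1) := by
    rw [hA', Set.InjOn.ncard_image, Set.ncard_coe_finset, card_powerset, Nat.card_Ico]
    intro S hS T hT h
    exact ofParts_injOn (mem_powerset.1 (mem_coe.1 hS)) (mem_powerset.1 (mem_coe.1 hT)) h
  have hB' : B = conjVertex '' A := by
    ext v
    constructor
    · rintro ⟨k, hk, h⟩
      exact ⟨conjVertex v, ⟨_, hk.conj, h.conj⟩, conjVertex_involutive n v⟩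
    · rintro ⟨u, ⟨k, hk, h⟩, rfl⟩
      exact ⟨_, hk.conj, h.conj⟩
  have hBcard : B.ncard = 2 ^ (n - 1) := by
    rw [hB', Set.ncard_image_of_injective _ (conjVertex_involutive n).injective, hAcard]
  have hinter : A ∩ B = {e n, w₀ n} := by
    ext v
    constructor
    · rintro ⟨⟨k, hk, h⟩, ⟨k', hk', h'⟩⟩
      exact eq_e_or_eq_w₀ hk hk' h h'
    · rintro (rfl | rfl)
      · exact ⟨⟨_, isLift_one n, fun j _ _ => by omega⟩, ⟨_, isLift_one n, fun j _ _ => by omega⟩⟩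
      · exact ⟨⟨_, isLift_revPerm n, fun j _ _ => by omega⟩,
          ⟨_, isLift_revPerm' n, fun j _ _ => by omega⟩⟩
  have h1 := Set.ncard_union_add_ncard_inter A B
  rw [hinter, Set.ncard_pair (e_ne_w₀ hn), hAcard, hBcard] at h1
  rw [hAB]
  obtain ⟨m, rfl⟩ : ∃ m, n = m + 1 := ⟨n - 1, by omega⟩
  rw [Nat.add_sub_cancel] at h1
  rw [pow_succ]
  omega

/-! ### Counting geodesics. -/

/-- The number of walks of length `m` from `e` to `v`. -/
noncomputable def walkCount {n : ℕ} (m : ℕ) (v : {π : Equiv.Perm (Fin n) // IsArc π}) : ℕ :=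
  {p : (arcGraph n).Walk (e n) v | p.length = m}.ncard

noncomputable instance (n : ℕ) : Fintype {π : Equiv.Perm (Fin n) // IsArc π} :=
  Fintype.ofFinite _

open scoped Classical in
theorem walkCount_eq_adjMatrix {n : ℕ} (m : ℕ) (v : {π : Equiv.Perm (Fin n) // IsArc π}) :
    walkCount m v = ((arcGraph n).adjMatrix ℕ ^ m) (e n) v := by
  rw [SimpleGraph.adjMatrix_pow_apply_eq_card_walk, walkCount, ← Nat.card_coe_set_eq,
    Nat.cast_id, Nat.card_eq_fintype_card]

open scoped Classical in
theorem walkCount_zero {n : ℕ} (v : {π : Equiv.Perm (Fin n) // IsArc π}) :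
    walkCount 0 v = if e n = v then 1 else 0 := by
  rw [walkCount_eq_adjMatrix, pow_zero, Matrix.one_apply]

open scoped Classical in
theorem walkCount_succ {n : ℕ} (m : ℕ) (v : {π : Equiv.Perm (Fin n) // IsArc π}) :
    walkCount (m + 1) v = ∑ u with (arcGraph n).Adj v u, walkCount m u := by
  rw [walkCount_eq_adjMatrix, pow_succ, Matrix.mul_apply, sum_filter]
  refine sum_congr rfl fun u _ => ?_
  rw [walkCount_eq_adjMatrix, SimpleGraph.adjMatrix_apply, (arcGraph n).adj_comm]
  split_ifs <;> simp

theorem walkCount_succ_of_support {n m : ℕ} {v : {π : Equiv.Perm (Fin n) // IsArc π}}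
    (T : Finset {π : Equiv.Perm (Fin n) // IsArc π}) (hT : ∀ u ∈ T, (arcGraph n).Adj v u)
    (hT' : ∀ u, (arcGraph n).Adj v u → u ∉ T → walkCount m u = 0) :
    walkCount (m + 1) v = ∑ u ∈ T, walkCount m u := by
  classical
  rw [walkCount_succ]
  refine (sum_subset (fun u hu => ?_) fun u hu hu' => ?_).symm
  · simpa using hT u hu
  · exact hT' u (by simpa using hu) hu'

theorem walkCount_conjVertex {n : ℕ} (m : ℕ) (v : {π : Equiv.Perm (Fin n) // IsArc π}) :
    walkCount m (conjVertex v) = walkCount m v := by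
  classical
  have hinv := conjVertex_involutive n
  induction m generalizing v with
  | zero =>
    rw [walkCount_zero, walkCount_zero]
    refine if_congr ⟨fun h => ?_, fun h => ?_⟩ rfl rfl
    · rw [← hinv v, ← h, conjVertex_e]
    · rw [← h, conjVertex_e]
  | succ m ih =>
    rw [walkCount_succ, walkCount_succ]
    refine sum_nbij' conjVertex conjVertex ?_ ?_ (fun u _ => hinv u) (fun u _ => hinv u)
      fun u _ => (ih u).symm
    · intro u hu
      rw [mem_filter] at hu ⊢
      have := adj_conjVertex hu.2
      rw [hinv] at this
      exact ⟨mem_univ _, this⟩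
    · intro u hu
      rw [mem_filter] at hu ⊢
      exact ⟨mem_univ _, adj_conjVertex hu.2⟩

/-- A walk from `e` of length `m` ends at a lift `k + n t` within distance `m` of `0`. Because `k`
takes values in `[-1, n]`, its distance from `0` is at least that of `k` if `t ≥ 0`, and at least
that of `k - n` if `t < 0`. -/
theorem walkCount_eq_zero {n m : ℕ} {k : ℕ → ℤ} {v : {π : Equiv.Perm (Fin n) // IsArc π}}
    (hk : IsLift k v.1) (hk1 : ∀ j, 1 ≤ j → j < n → -1 ≤ k j ∧ k j ≤ n)
    (h0 : m < pathDist n k fun _ => 0) (hn : m < pathDist n k fun _ => n) :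
    walkCount m v = 0 := by
  suffices h : {p : (arcGraph n).Walk (e n) v | p.length = m} = ∅ by
    rw [walkCount, h, Set.ncard_empty]
  refine Set.eq_empty_iff_forall_notMem.2 fun p hp => ?_
  have hp : p.length = m := hp
  obtain ⟨k', hk', hd⟩ := (isLift_one n).exists_lift_of_walk p
  obtain ⟨t, ht⟩ := hk.exists_eq_add hk'
  rcases le_or_gt 0 t with h | h
  · have h1 : t = 0 ∨ (n : ℤ) ≤ n * t := by
      rcases h.eq_or_lt with h | h
      · exact Or.inl h.symm
      · right; nlinarith
    have : pathDist n k (fun _ => 0) ≤ pathDist n (fun _ => 0) k' := by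
      refine sum_le_sum fun j hj => ?_
      rw [mem_Ico] at hj
      have := hk1 j hj.1 hj.2
      rw [ht j hj.1 hj.2]
      rcases h1 with rfl | h1
      · simp
      · dsimp only
        omega
    omega
  · have h1 : (n : ℤ) * t ≤ -n := by nlinarith
    have : pathDist n k (fun _ => n) ≤ pathDist n (fun _ => 0) k' := by
      refine sum_le_sum fun j hj => ?_
      rw [mem_Ico] at hj
      have := hk1 j hj.1 hj.2
      rw [ht j hj.1 hj.2]
      dsimp only
      omega
    omega

/-- The shifted shape obtained by shortening the part `s` by one. -/
def lowerPart (S : Finset ℕ) (s : ℕ) : Finset ℕ := (insert (s - 1) (S.erase s)).erase 0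

theorem mem_lowerPart {S : Finset ℕ} {s i : ℕ} :
    i ∈ lowerPart S s ↔ i ≠ 0 ∧ (i = s - 1 ∨ i ≠ s ∧ i ∈ S) := by
  simp [lowerPart]

theorem lowerPart_subset {n : ℕ} {S : Finset ℕ} (hS : S ⊆ Ico 1 n) {s : ℕ} (hs : s ∈ S) :
    lowerPart S s ⊆ Ico 1 n := by
  intro i hi
  rw [mem_lowerPart] at hi
  have := mem_Ico.1 (hS hs)
  rcases hi.2 with h | h
  · rw [mem_Ico]
    omega
  · exact hS h.2

theorem sum_lowerPart {S : Finset ℕ} (hS : 0 ∉ S) {s : ℕ} (hs : s ∈ S) (hs' : s - 1 ∉ S) :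
    ∑ i ∈ lowerPart S s, i + 1 = ∑ i ∈ S, i := by
  have h0 : s ≠ 0 := fun h => hS (h ▸ hs)
  rw [lowerPart, sum_erase (f := fun i => i) _ rfl, sum_insert (fun h => hs' (mem_of_mem_erase h)),
    ← add_sum_erase S (fun i => i) hs]
  omega

theorem columns_lowerPart {n : ℕ} {S : Finset ℕ} (hS : S ⊆ Ico 1 n) {s : ℕ} (hs : s ∈ S)
    (hs' : s - 1 ∉ S) {j : ℕ} (h1 : 1 ≤ j) :
    columns (lowerPart S s) j = columns S j - if j = s then 1 else 0 := by
  have hsn := mem_Ico.1 (hS hs)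
  have key : ∀ m j, 1 ≤ j → n ≤ j + m →
      columns (lowerPart S s) j = columns S j - if j = s then 1 else 0 := by
    intro m
    induction m with
    | zero =>
      intro j h1 h2
      rw [columns_eq_zero hS (j := j) h2, columns_eq_zero (lowerPart_subset hS hs) (j := j) h2,
        if_neg (by omega), sub_zero]
    | succ m ih =>
      intro j h1 h2
      have h3 := ih (j + 1) (by omega) (by omega)
      rw [columns_succ S j, columns_succ (lowerPart S s) j, h3]
      by_cases h4 : j = s
      · subst h4
        have : j ∉ lowerPart S j := fun h => by rw [mem_lowerPart] at h; omega
        simp [hs, this]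
      · by_cases h5 : j + 1 = s
        · have e1 : j ∉ S := by rwa [← h5] at hs'
          have e2 : j ∈ lowerPart S s := mem_lowerPart.2 (by omega)
          simp [e1, e2, h5, h4]
        · have e1 : j ∈ lowerPart S s ↔ j ∈ S := by
            rw [mem_lowerPart]
            constructor
            · rintro ⟨_, h | h⟩
              · omega
              · exact h.2
            · exact fun h => ⟨by omega, Or.inr ⟨h4, h⟩⟩
          simp [e1, h4, h5]
  exact key n j h1 (by omega)

theorem IsLift.mul_simpleSwap_eq_ofParts {n j : ℕ} {S : Finset ℕ} {k : ℕ → ℤ}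
    {v : {π : Equiv.Perm (Fin n) // IsArc π}} (hk : IsLift k v.1) (h1 : 1 ≤ j) (h2 : j < n) {b : ℤ}
    (hb : b = k j + 1 ∨ b = k j - 1)
    (h : ∀ i, 1 ≤ i → i < n → Function.update k j b i = columns S i) :
    v.1 * simpleSwap j h1 h2 = (ofParts n S).1 := by
  have hp : IsPath n (Function.update k j b) := by
    intro i hi1 hi2
    rw [h i hi1 (by omega), h (i + 1) (by omega) hi2]
    exact isPath_columns n S i hi1 hi2
  exact (hk.update h1 h2 hb hp).perm_unique (isLift_ofParts n S) h

theorem ofParts_lowerPart {n : ℕ} {S : Finset ℕ} (hS : S ⊆ Ico 1 n) {s : ℕ} (hs : s ∈ S)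
    (hs' : s - 1 ∉ S) : (ofParts n (lowerPart S s)).1 =
      (ofParts n S).1 * simpleSwap s (mem_Ico.1 (hS hs)).1 (mem_Ico.1 (hS hs)).2 := by
  refine ((isLift_ofParts n S).mul_simpleSwap_eq_ofParts _ _ (Or.inr rfl) fun i h1 h2 => ?_).symm
  rw [columns_lowerPart hS hs hs' h1]
  by_cases h : i = s
  · subst h
    simp
  · simp [h]

/-- The last step of such a walk adds a box, so the count obeys the recurrence of `shiftedCount`.
Strictness of `hN` keeps the translate by `-n` out of reach; at `n.choose 2` the lower region
contributes as well. -/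
theorem walkCount_ofParts {n : ℕ} (N : ℕ) (hN : N < n.choose 2) {S : Finset ℕ} (hS : S ⊆ Ico 1 n)
    (hSN : ∑ s ∈ S, s = N) : (walkCount N (ofParts n S) : ℚ) = shiftedCount S := by
  have h0 : ∀ {S : Finset ℕ}, S ⊆ Ico 1 n → 0 ∉ S := fun h h' => by simpa using h h'
  induction N generalizing S with
  | zero =>
    have hSe : S = ∅ := by
      rw [eq_empty_iff_forall_notMem]
      intro s hs
      have := sum_eq_zero_iff.1 hSN s hs
      exact h0 hS (this ▸ hs)
    subst hSe
    rw [ofParts_empty, walkCount_zero, if_pos rfl]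
    simp [shiftedCount, shiftedWeight]
  | succ N ih =>
    have hne : S.Nonempty := by
      rw [nonempty_iff_ne_empty]
      rintro rfl
      simp at hSN
    classical
    set F := S.filter (fun s => s - 1 ∉ S) with hF
    have hup := isUpper_columns hS
    have hlift := isLift_ofParts n S
    have hsucc : walkCount (N + 1) (ofParts n S) =
        ∑ u ∈ F.image (fun s => ofParts n (lowerPart S s)), walkCount N u := by
      apply walkCount_succ_of_support
      · intro u hu
        rw [mem_image] at hu
        obtain ⟨s, hs, rfl⟩ := hu
        rw [mem_filter] at hs
        exact (arcGraph_adj_iff _ _).2 ⟨s, _, _, ofParts_lowerPart hS hs.1 hs.2⟩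
      · intro u hu huF
        obtain ⟨j, h1, h2, hj⟩ := (arcGraph_adj_iff _ _).1 hu
        obtain ⟨b, hb, hL⟩ := hlift.exists_update h1 h2 (hj ▸ u.2)
        have hL' : IsLift (Function.update (columns S) j b) u.1 := by rwa [hj]
        have hd0 := pathDist_update_add (columns S) (fun _ => 0) h1 h2 b
        have hdn := pathDist_update_add (columns S) (fun _ => (n : ℤ)) h1 h2 b
        have hp0 := pathDist_columns hS
        have hpn : pathDist n (columns S) (fun _ => (n : ℤ)) + ∑ s ∈ S, s = 2 * n.choose 2 := by
          rw [← hp0, ← sum_Ico_const, pathDist, pathDist, ← sum_add_distrib]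
          refine sum_congr rfl fun i hi => ?_
          rw [mem_Ico] at hi
          have := hup i hi.1 hi.2
          omega
        have hbj := hup j h1 h2
        -- Only lowering a positive column removes a box, and validity of the new path makes that
        -- box a corner. Every other move leads further from `0`, to a vertex that `N` steps cannot
        -- reach.
        by_cases hcase : b = columns S j - 1 ∧ 1 ≤ columns S j
        · exfalso
          have hjS : j ∈ S := by
            by_contra hjS
            have e1 := columns_succ S j
            rw [if_neg hjS] at e1
            rcases Nat.lt_or_ge (j + 1) n with h3 | h3
            · have e2 := hL.isPath j h1 h3
              rw [Function.update_self, Function.update_of_ne (by omega)] at e2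
              omega
            · rw [columns_eq_zero hS h3] at e1
              omega
          have hjS' : j - 1 ∉ S := by
            intro hj'
            have h3 := mem_Ico.1 (hS hj')
            have e1 := columns_succ S (j - 1)
            have e2 := hL.isPath (j - 1) h3.1 (by omega)
            rw [if_pos hj', Nat.sub_add_cancel h1] at e1
            rw [Nat.sub_add_cancel h1, Function.update_self,
              Function.update_of_ne (by omega)] at e2
            omega
          refine huF (mem_image.2 ⟨j, mem_filter.2 ⟨hjS, hjS'⟩, Subtype.ext ?_⟩)
          rw [ofParts_lowerPart hS hjS hjS', hj]
        · refine walkCount_eq_zero hL' (fun i hi1 hi2 => ?_) ?_ ?_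
          · have := hup i hi1 hi2
            by_cases hij : i = j
            · subst hij
              rw [Function.update_self]
              omega
            · rw [Function.update_of_ne hij]
              omega
          · omega
          · omega
    have hinj : Set.InjOn (fun s => ofParts n (lowerPart S s)) (F : Set ℕ) := by
      intro s hs s' hs' h
      have hs := mem_filter.1 (mem_coe.1 hs)
      have hs' := mem_filter.1 (mem_coe.1 hs')
      have heq := ofParts_injOn (lowerPart_subset hS hs.1) (lowerPart_subset hS hs'.1) h
      by_contra hne
      have hs0 : s ≠ 0 := fun h => h0 hS (h ▸ hs.1)
      have h1 : s ∈ lowerPart S s' := mem_lowerPart.2 ⟨hs0, Or.inr ⟨hne, hs.1⟩⟩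
      rw [← heq, mem_lowerPart] at h1
      omega
    rw [hsucc, sum_image hinj, Nat.cast_sum, shiftedCount_eq_sum (h0 hS) hne]
    refine sum_congr rfl fun s hs => ?_
    have hs := mem_filter.1 hs
    have hsum := sum_lowerPart (h0 hS) hs.1 hs.2
    exact ih (by omega) (lowerPart_subset hS hs.1) (by omega)

theorem walkCount_w₀ {n : ℕ} (hn : 3 ≤ n) :
    (walkCount (n.choose 2) (w₀ n) : ℚ) = 2 * shiftedCount (Ico 1 n) := by
  classical
  have h1n : 1 ∈ Ico 1 n := mem_Ico.2 ⟨le_rfl, by omega⟩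
  have h0n : 1 - 1 ∉ Ico 1 n := by simp
  set S := lowerPart (Ico 1 n) 1 with hSdef
  have hS : S ⊆ Ico 1 n := lowerPart_subset le_rfl h1n
  have hsum : ∑ s ∈ S, s + 1 = n.choose 2 := by
    rw [← sum_Ico_id]
    exact sum_lowerPart (by simp) h1n h0n
  set u := ofParts n S with hu
  have hu1 : u.1 = (w₀ n).1 * simpleSwap 1 le_rfl (by omega) := by
    rw [hu, ofParts_lowerPart le_rfl h1n h0n, ofParts_Ico]
  have hadj : (arcGraph n).Adj (w₀ n) u := (arcGraph_adj_iff _ _).2 ⟨1, le_rfl, by omega, hu1⟩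
  have hadj' : (arcGraph n).Adj (w₀ n) (conjVertex u) := by
    have := adj_conjVertex hadj
    rwa [conjVertex_w₀] at this
  -- A common vertex of the two regions is `e` or `w₀`; the staircase without its last box is
  -- neither empty, thanks to `n ≥ 3`, nor full.
  have hne : u ≠ conjVertex u := by
    intro h
    have hL := (isLift_ofParts n S).conj
    have h2 := eq_e_or_eq_w₀ (isLift_ofParts n S) (k' := fun j => -columns S (n - j))
      (by rw [← hu, h]; exact hL) (isUpper_columns hS) (isUpper_columns hS).conj
    rw [← ofParts_empty, ← ofParts_Ico] at h2
    rcases h2 with h2 | h2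
    · have h3 := ofParts_injOn hS (empty_subset _) h2
      have h4 : 2 ∈ S := mem_lowerPart.2 ⟨by omega, Or.inr ⟨by omega, mem_Ico.2 (by omega)⟩⟩
      rw [h3] at h4
      exact notMem_empty _ h4
    · have h3 := ofParts_injOn hS le_rfl h2
      rw [← h3, mem_lowerPart] at h1n
      omega
  have hsucc : walkCount (∑ s ∈ S, s + 1) (w₀ n) =
      ∑ v ∈ ({u, conjVertex u} : Finset _), walkCount (∑ s ∈ S, s) v := by
    apply walkCount_succ_of_support
    · intro v hv
      rw [mem_insert, mem_singleton] at hv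
      rcases hv with rfl | rfl
      · exact hadj
      · exact hadj'
    · intro v hv hvT
      exfalso
      apply hvT
      rw [mem_insert, mem_singleton]
      obtain ⟨j, h1, h2, hj⟩ := (arcGraph_adj_iff _ _).1 hv
      obtain ⟨b, hb, hL⟩ := (isLift_revPerm n).exists_update h1 h2 (hj ▸ v.2)
      -- The lift `n - j` descends at every step, so changing an interior term would create a step
      -- of `-2`.
      have hj1 : j = 1 ∨ j = n - 1 := by
        by_contra hcon
        have e1 := hL.isPath (j - 1) (by omega) (by omega)
        have e2 := hL.isPath j h1 (by omega)
        rw [Nat.sub_add_cancel h1, Function.update_self, Function.update_of_ne (by omega)] at e1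
        rw [Function.update_self, Function.update_of_ne (by omega)] at e2
        omega
      rcases hj1 with rfl | rfl
      · left
        exact Subtype.ext (hj.trans hu1.symm)
      · right
        refine Subtype.ext ?_
        change v.1 = conj u.1
        have hw : conj (w₀ n).1 = (w₀ n).1 := congrArg Subtype.val (conjVertex_w₀ n)
        rw [hj, hu1, conj_mul, conj_simpleSwap, hw]
  rw [← hsum, hsucc, sum_pair hne, walkCount_conjVertex, Nat.cast_add,
    walkCount_ofParts _ (by omega) hS rfl, shiftedCount_eq_sum (S := Ico 1 n) (by simp) ⟨1, h1n⟩]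
  have hF : (Ico 1 n).filter (fun s => s - 1 ∉ Ico 1 n) = {1} := by
    ext s
    simp only [mem_filter, mem_Ico, mem_singleton]
    omega
  rw [hF, sum_singleton, ← lowerPart, two_mul]

theorem ncard_geodesics {n : ℕ} (hn : 3 ≤ n) :
    ((geodesics (arcGraph n) (e n) (w₀ n)).ncard : ℚ) =
      2 * ((n.choose 2).factorial : ℚ) *
        ∏ i ∈ range (n - 1), (i.factorial : ℚ) / ((2 * i + 1).factorial : ℚ) := by
  have h : (geodesics (arcGraph n) (e n) (w₀ n)).ncard = walkCount (n.choose 2) (w₀ n) := by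
    rw [geodesics, dist_e_w₀, walkCount]
  rw [h, walkCount_w₀ hn, shiftedCount_Ico (by omega), mul_assoc]

end ArcPerm

theorem mainTheorem3 (n : ℕ) (hn : 1 ≤ n) :
    ((ArcPerm.arcGraph n).Connected ∧ (ArcPerm.arcGraph n).diam = n.choose 2) ∧
    ArcPerm.AreAntipodes (ArcPerm.arcGraph n) (ArcPerm.e n) (ArcPerm.w₀ n) ∧
    (Subtype.val '' ArcPerm.geodesicVertices (ArcPerm.arcGraph n) (ArcPerm.e n) (ArcPerm.w₀ n) =
        {π : Equiv.Perm (Fin n) | ArcPerm.IsUnimodal π} ∧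
      (2 ≤ n →
        (ArcPerm.geodesicVertices (ArcPerm.arcGraph n) (ArcPerm.e n) (ArcPerm.w₀ n)).ncard =
          2 ^ n - 2)) ∧
    (3 ≤ n →
      ((ArcPerm.geodesics (ArcPerm.arcGraph n) (ArcPerm.e n) (ArcPerm.w₀ n)).ncard : ℚ) =
        2 * ((n.choose 2).factorial : ℚ) *
          ∏ i ∈ Finset.range (n - 1), (i.factorial : ℚ) / ((2 * i + 1).factorial : ℚ)) := by
  refine ⟨⟨ArcPerm.arcGraph_connected n, ArcPerm.diam_arcGraph n⟩, ?_,
    ⟨?_, ArcPerm.ncard_geodesicVertices⟩, ArcPerm.ncard_geodesics⟩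
  · rw [ArcPerm.AreAntipodes, ArcPerm.dist_e_w₀, ArcPerm.diam_arcGraph]
  · ext π
    change _ ↔ ArcPerm.IsUnimodal π
    rw [ArcPerm.isUnimodal_iff, Set.mem_image]
    constructor
    · rintro ⟨v, hv, rfl⟩
      exact (ArcPerm.mem_geodesicVertices_iff v).1 hv
    · rintro ⟨k, hk, h⟩
      exact ⟨⟨π, hk.isArc⟩, (ArcPerm.mem_geodesicVertices_iff _).2 ⟨k, hk, h⟩, rfl⟩
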